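/- **Setting.** Let $1<p\le 2$, $d\ge 1$, $L\ge 1$, and $B,\sigma_p,\lambda>0$. In round $t=1,2,\dots$ a context $x_t\in\mathbb R^d$ is revealed, the broker posts a price $P_t$ and then observes both valuations $V_t=m(x_t)+\xi_t$ and $W_t=m(x_t)+\zeta_t$ (full feedback), where $m(x)=x^\top\phi$ with $\phi\in\mathbb R^d$ unknown and $\|\phi\|\le B$. The contexts and noises $(x_t),(\xi_t),(\zeta_t)$ are mutually independent; the $x_t$ are identically distributed with $\|x_t\|\le 1$ a.s. and $\mathbb E[x_tx_t^\top]\succeq\lambda I_d$; each $\xi_t$ and $\zeta_t$ has mean zero, a density bounded by $L$, and $\mathbb E|\xi_t|^p\le\sigma_p^p$, $\mathbb E|\zeta_t|^p\le\sigma_p^p$ (the noises need not be identically distributed over time). The gain from trade is $g(\pi,v,w)=(v\vee w-v\wedge w)\,\mathbf 1\{v\wedge w\le \pi\le v\vee w\}$ and the regret is $R_T=\sum_{t=1}^T\mathbb E[g(m(x_t),V_t,W_t)-g(P_t,V_t,W_t)]$. **Algorithm** (horizon $T$; $p,B,\sigma_p$ known). Split the rounds into epochs $[2^{k-1},2^k)$,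 $k=1,2,\dots$ (cut off at $T$). In epoch $1$ post any fixed price. For $k\ge 2$, take the $n=2^{k-2}$ observations of epoch $k-1$, put $S_s=x_s(V_s+W_s)/2$, and let $$\hat\mu_j=\frac1n\sum_s [S_s]_j\mathbf 1\{|[S_s]_j|\le\tau\},\quad \tau=\Big(\frac{(B+\sigma_p)^p\,n}{\log(dT)}\Big)^{1/p},\quad \hat\Sigma=\frac1n\sum_s x_sx_s^\top,\quad \hat\phi_k=\hat\Sigma^{-1}\hat\mu$$ (with $\hat\phi_k=0$ if $\hat\Sigma$ is singular). Post $P_t=x_t^\top\hat\phi_k$ in all rounds $t$ of epoch $k$. **Theorem.** There is an absolute constant $C$ such that, for all parameters, instances and horizons $T\ge 1$ as above, the loss in every round is integrable and $$R_T\le C\,\Big(\frac{1+B/\sigma_p}{\lambda}\Big)^{2}\,(1+\log(dT))^{2}\; L\,d\,\sigma_p^2\,T^{(2-p)/p}.$$ In particular $R_T=\widetilde O(L\,d\,\sigma_p^2\,T^{(2-p)/p})$ for $p\in(1,2)$, and $R_T=\widetilde O(L\,d\,\sigma_p^2)$ for $p=2$. -/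

import Mathlib

open MeasureTheory ProbabilityTheory

noncomputable section

namespace BilateralTrade

/-- The gain from trade `g(π, v, w) = (v ∨ w - v ∧ w) · 1{v ∧ w ≤ π ≤ v ∨ w}`
at price `π` and valuations `v`, `w`. -/
def gain (π v w : ℝ) : ℝ :=
  if min v w ≤ π ∧ π ≤ max v w then max v w - min v w else 0

/-- Contexts: `ℝ^d` with its Euclidean norm. -/
abbrev Context (d : ℕ) : Type := EuclideanSpace ℝ (Fin d)

/-- What the broker knows about a finished round (full feedback): the context and the two
valuations, `(x, V, W)`. -/
abbrev Obs (d : ℕ) : Type := Context d × ℝ × ℝ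

/-- A (deterministic) pricing algorithm. The price of round `t` is a function of the observations
of the rounds `1, …, t - 1` and of the context of round `t`. Rounds are numbered from `1`. -/
abbrev Policy (d : ℕ) : Type := (t : ℕ) → (Finset.Ico 1 t → Obs d) → Context d → ℝ

/-- The linear market value `m(x) = xᵀ φ`. -/
def marketValue {d : ℕ} (φ x : Context d) : ℝ := ∑ j, x j * φ j

/-- The law of the real random variable `X` has a density (with respect to Lebesgue measure)
that is bounded by `L`. -/
def HasDensityBoundedBy {Ω : Type*} [MeasurableSpace Ω] (X : Ω → ℝ) (μ : Measure Ω) (L : ℝ) :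
    Prop :=
  ∃ f : ℝ → ENNReal, Measurable f ∧ (∀ y, f y ≤ ENNReal.ofReal L) ∧
    μ.map X = (volume : Measure ℝ).withDensity f

/-- The second-moment matrix `E[X Xᵀ]` of a random vector. -/
def secondMoment {Ω : Type*} [MeasurableSpace Ω] {d : ℕ} (X : Ω → Context d) (μ : Measure Ω) :
    Matrix (Fin d) (Fin d) ℝ :=
  Matrix.of fun i j => ∫ ω, X ω i * X ω j ∂μ

section Interaction

variable {Ω : Type*} {d : ℕ}

/-- The valuation `m(x_t) + (noise)_t` of a trader in round `t`. -/
def valuation (φ : Context d) (x : ℕ → Ω → Context d) (noise : ℕ → Ω → ℝ) (t : ℕ) (ω : Ω) : ℝ :=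
  marketValue φ (x t ω) + noise t ω

/-- The price that the policy `A` posts in round `t`. -/
def price (A : Policy d) (φ : Context d) (x : ℕ → Ω → Context d) (ξ ζ : ℕ → Ω → ℝ)
    (t : ℕ) (ω : Ω) : ℝ :=
  A t (fun s => (x s ω, valuation φ x ξ s ω, valuation φ x ζ s ω)) (x t ω)

/-- The loss of round `t`: `g(m(x_t), V_t, W_t) - g(P_t, V_t, W_t)`. -/
def loss (A : Policy d) (φ : Context d) (x : ℕ → Ω → Context d) (ξ ζ : ℕ → Ω → ℝ)
    (t : ℕ) (ω : Ω) : ℝ :=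
  gain (marketValue φ (x t ω)) (valuation φ x ξ t ω) (valuation φ x ζ t ω)
    - gain (price A φ x ξ ζ t ω) (valuation φ x ξ t ω) (valuation φ x ζ t ω)

/-- The regret `R_T = ∑_{t=1}^T E[g(m(x_t), V_t, W_t) - g(P_t, V_t, W_t)]`. -/
def regret [MeasurableSpace Ω] (μ : Measure Ω) (A : Policy d) (φ : Context d)
    (x : ℕ → Ω → Context d) (ξ ζ : ℕ → Ω → ℝ) (T : ℕ) : ℝ :=
  ∑ t ∈ Finset.Icc 1 T, ∫ ω, loss A φ x ξ ζ t ω ∂μ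

end Interaction

section Algorithm

variable {d n : ℕ}

/-- The `j`-th coordinate of the score vector `x · (V + W) / 2` of an observation. -/
def score (o : Obs d) (j : Fin d) : ℝ := o.1 j * ((o.2.1 + o.2.2) / 2)

/-- Coordinate-wise truncated mean, at level `τ`, of the score vectors of a sample of size `n`. -/
def truncatedMean (τ : ℝ) (sample : Fin n → Obs d) (j : Fin d) : ℝ :=
  (n : ℝ)⁻¹ * ∑ s, if |score (sample s) j| ≤ τ then score (sample s) j else 0

/-- The empirical Gram matrix `n⁻¹ ∑ x_s x_sᵀ`. -/
def gram (sample : Fin n → Obs d) : Matrix (Fin d) (Fin d) ℝ :=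
  Matrix.of fun i j => (n : ℝ)⁻¹ * ∑ s, (sample s).1 i * (sample s).1 j

/-- The truncation level `τ = (u n / log (d T))^{1/p}` with `u = (B + σ)^p`. -/
def truncationLevel (d T : ℕ) (p B σ : ℝ) (n : ℕ) : ℝ :=
  ((B + σ) ^ p * n / Real.log (d * T)) ^ (1 / p)

/-- The estimate of `φ`: the inverse Gram matrix applied to the truncated means. (The inverse of a
singular matrix is `0` by convention, so the algorithm then posts the price `0`.) -/
def estimate (T : ℕ) (p B σ : ℝ) (sample : Fin n → Obs d) : Fin d → ℝ :=
  (gram sample)⁻¹.mulVec (truncatedMean (truncationLevel d T p B σ n) sample)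

/-- The length `n` of the epoch before the one that contains round `t`. The epochs are
`[1, 2), [2, 4), [4, 8), …`; if `2 ≤ t` lies in `[2n, 4n)`, then the previous epoch is
`[n, 2n)`. -/
def prevLength (t : ℕ) : ℕ := 2 ^ (Nat.log 2 t - 1)

theorem prevLength_mem {t : ℕ} (ht : 2 ≤ t) (i : Fin (prevLength t)) :
    prevLength t + i ∈ Finset.Ico 1 t := by
  have h1 : 1 ≤ Nat.log 2 t := Nat.log_pos (by norm_num) ht
  have h2 : 2 ^ Nat.log 2 t ≤ t := Nat.pow_log_le_self 2 (by omega)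
  have h3 : 2 ^ Nat.log 2 t = 2 * prevLength t := by
    unfold prevLength
    rw [← pow_succ']
    congr 1
    omega
  have h4 : 0 < prevLength t := by unfold prevLength; positivity
  have h5 := i.isLt
  rw [Finset.mem_Ico]
  omega

/-- The epoch-doubling algorithm with horizon `T` and known `p`, `B`, `σ`. In the first epoch
(the single round `1`) it posts the fixed price `π₀`; in every later round `t` it posts
`x_tᵀ φ̂`, where `φ̂` is the estimate from the observations of the previous epoch. -/
def epochPolicy (d T : ℕ) (p B σ π₀ : ℝ) : Policy d := fun t hist x =>
  if ht : 2 ≤ t then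
    ∑ j, x j * estimate T p B σ
      (fun i : Fin (prevLength t) => hist ⟨prevLength t + i, prevLength_mem ht i⟩) j
  else π₀

end Algorithm

end BilateralTrade

end

/-!
The regret of a price that misses the market value by `δ` is quadratic in `δ`. Up to ties, which
are null because the noises have densities, the gain from trade at `m + δ` is
`(ξ - ζ) (1{ζ ≤ δ} - 1{ξ ≤ δ})`. The mixed terms `E[ξ 1{ζ ≤ δ}]` vanish by independence and
centring, so that the expected loss is at most the sum over the two noises `z` of
`E[z (1{z ≤ δ} - 1{z ≤ 0})]`, the integral of `|z|` over the values between `0` and `δ`. This is at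
most `L δ ^ 2` by the density bound and at most `σ` by the moment bound
(`integral_gain_zero_sub_gain_le`). The price of a round is independent of its noises, so Fubini
carries the bound over to random `δ` (`integral_gain_zero_sub_gain_random_le`).

It remains to bound `E min(L δ ^ 2, σ)` for `δ = xᵀ (φ̂ - φ)`. The residual `μ̂ - Σ̂ φ` of the
normal equations and the error `Σ̂ - Σ` of the Gram matrix control it pathwise
(`min_le_residual_add_frobenius`): where `‖Σ̂ - Σ‖ ≤ lam / 2` in Frobenius norm, `Σ̂ ⪰ (lam / 2) I`
and `‖φ̂ - φ‖ ≤ (2 / lam) ‖μ̂ - Σ̂ φ‖`; elsewhere `(4 / lam ^ 2) ‖Σ̂ - Σ‖ ^ 2` exceeds `1`. Hence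
second moments of empirical means suffice, and no concentration inequality for matrices is needed.
Both `μ̂` and `Σ̂ φ` estimate `Σ φ`. With `ρ = log (d T) / n` and the prescribed level `τ`, each
truncated mean has bias at most `τ ρ = (B + σ) ρ ^ (1 - 1 / p)` and variance at most
`(τ ρ) ^ 2 / log (d T)` (`Market.integral_truncatedMean_sub_sq_le`), while `E ‖Σ̂ - Σ‖ ^ 2 ≤ 1 / n`
(`Market.integral_frobenius_gram_sub_le`).

Since `n ≥ t / 4`, the expected loss of round `t` is of order `t ^ (-(2 - 2 / p))`
(`Market.integral_loss_le`). Writing `t ^ (-a) ≤ t⁻¹ T ^ (1 - a)` and summing the harmonic series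
gives the rate `T ^ ((2 - p) / p)`, uniformly in `p ≤ 2`, at the price of one logarithm. The terms
that carry no factor `L` are absorbed by `1 ≤ 8 L σ`, which holds because a bounded density cannot
concentrate around `0`.
-/

namespace BilateralTrade

/-! ### The expected loss of a round -/

lemma gain_nonneg (π v w : ℝ) : 0 ≤ gain π v w := by
  unfold gain
  split_ifs
  · exact sub_nonneg.2 min_le_max
  · exact le_rfl

lemma gain_le_abs_add_abs (π v w : ℝ) : gain π v w ≤ |v| + |w| := by
  have h : max v w - min v w ≤ |v| + |w| := by
    rw [max_sub_min_eq_abs]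
    exact (abs_sub w v).trans (by rw [add_comm])
  unfold gain
  split_ifs
  · exact h
  · positivity

/-- The gain from trade is translation invariant, so the market value may be taken to be `0`. -/
lemma gain_add_left (m π v w : ℝ) : gain (m + π) (m + v) (m + w) = gain π v w := by
  simp only [gain, max_add_add_left, min_add_add_left, add_le_add_iff_left, add_sub_add_left_eq_sub]

lemma measurable_gain : Measurable fun q : ℝ × ℝ × ℝ => gain q.1 q.2.1 q.2.2 := by
  unfold gain
  refine Measurable.ite ?_ (by fun_prop) measurable_const
  have h1 : MeasurableSet {q : ℝ × ℝ × ℝ | min q.2.1 q.2.2 ≤ q.1} :=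
    measurableSet_le (by fun_prop) (by fun_prop)
  have h2 : MeasurableSet {q : ℝ × ℝ × ℝ | q.1 ≤ max q.2.1 q.2.2} :=
    measurableSet_le (by fun_prop) (by fun_prop)
  exact h1.inter h2

/-- The difference `1{z ≤ δ} - 1{z ≤ 0}`. -/
noncomputable def stepDiff (δ z : ℝ) : ℝ :=
  (if z ≤ δ then 1 else 0) - (if z ≤ 0 then 1 else 0)

lemma measurable_stepDiff (δ : ℝ) : Measurable (stepDiff δ) :=
  (Measurable.ite measurableSet_Iic measurable_const measurable_const).sub
    (Measurable.ite measurableSet_Iic measurable_const measurable_const)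

lemma abs_stepDiff_le (δ z : ℝ) : |stepDiff δ z| ≤ 1 := by
  unfold stepDiff
  split_ifs <;> simp

lemma mul_stepDiff_le (δ z : ℝ) :
    z * stepDiff δ z ≤ |δ| * (Set.uIoc 0 δ).indicator 1 z := by
  unfold stepDiff
  by_cases hz : z ∈ Set.uIoc 0 δ
  · rw [Set.indicator_of_mem hz]
    rw [Set.mem_uIoc] at hz
    rcases hz with ⟨h1, h2⟩ | ⟨h1, h2⟩
    · rw [if_pos h2, if_neg h1.not_ge, abs_of_pos (h1.trans_le h2)]
      simpa using h2
    · rw [if_neg h1.not_ge, if_pos h2, abs_of_neg (h1.trans_le h2)]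
      simp only [Pi.one_apply]
      linarith
  · rw [Set.indicator_of_notMem hz]
    simp only [Set.mem_uIoc, not_or, not_and, not_le] at hz
    by_cases h1 : z ≤ δ <;> by_cases h2 : z ≤ 0
    · simp [h1, h2]
    · exact absurd (hz.1 (not_le.1 h2)) h1.not_gt
    · exact absurd (hz.2 (not_le.1 h1)) h2.not_gt
    · simp [h1, h2]

/-- Away from ties, the loss of a price that is off by `δ` is at most
`(v - w) (s(v) - s(w))`, where `s = stepDiff δ`. -/
lemma gain_zero_sub_gain_le {v w : ℝ} (hv : v ≠ 0) (hw : w ≠ 0) (δ : ℝ) :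
    gain 0 v w - gain δ v w ≤ (v - w) * (stepDiff δ v - stepDiff δ w) := by
  have h0 : gain 0 v w ≤ (v - w) * ((if w ≤ 0 then 1 else 0) - (if v ≤ 0 then 1 else 0)) := by
    unfold gain
    rcases lt_or_gt_of_ne hv with hv | hv <;> rcases lt_or_gt_of_ne hw with hw | hw
    · simp [hv.le, hw.le, hv.not_ge, hw.not_ge]
    · have : v < w := hv.trans hw
      simp [hv.le, hw.le, hw.not_ge, max_eq_right this.le, min_eq_left this.le]
    · have : w < v := hw.trans hv
      simp [hv.le, hw.le, hv.not_ge, max_eq_left this.le, min_eq_right this.le]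
    · simp [hv.not_ge, hw.not_ge]
  have h1 : (v - w) * ((if w ≤ δ then 1 else 0) - (if v ≤ δ then 1 else 0)) ≤ gain δ v w := by
    by_cases hv : v ≤ δ <;> by_cases hw : w ≤ δ
    · simpa [hv, hw] using gain_nonneg δ v w
    · have : v < w := hv.trans_lt (not_le.1 hw)
      simp [gain, hv, hw, max_eq_right this.le, min_eq_left this.le, (not_le.1 hw).le]
    · have : w < v := hw.trans_lt (not_le.1 hv)
      simp [gain, hv, hw, max_eq_left this.le, min_eq_right this.le, (not_le.1 hv).le]
    · simpa [hv, hw] using gain_nonneg δ v w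
  unfold stepDiff
  linarith

section

variable {Ω : Type*} [MeasurableSpace Ω] {μ : Measure Ω}

lemma HasDensityBoundedBy.map_apply_le {X : Ω → ℝ} {L : ℝ} (h : HasDensityBoundedBy X μ L)
    {A : Set ℝ} (hA : MeasurableSet A) : μ.map X A ≤ ENNReal.ofReal L * volume A := by
  obtain ⟨f, -, hfL, hmap⟩ := h
  rw [hmap, withDensity_apply _ hA]
  exact (lintegral_mono hfL).trans (by simp)

lemma HasDensityBoundedBy.ae_ne_zero {X : Ω → ℝ} {L : ℝ} (h : HasDensityBoundedBy X μ L)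
    (hX : Measurable X) : ∀ᵐ ω ∂μ, X ω ≠ 0 := by
  have h0 : μ.map X {0} = 0 := by
    simpa using h.map_apply_le (measurableSet_singleton (0 : ℝ))
  rw [Measure.map_apply hX (measurableSet_singleton _)] at h0
  exact measure_eq_zero_iff_ae_notMem.1 h0

lemma HasDensityBoundedBy.measureReal_uIoc_le [IsFiniteMeasure μ] {X : Ω → ℝ} {L : ℝ} (hL : 0 ≤ L)
    (h : HasDensityBoundedBy X μ L) (hX : Measurable X) (a b : ℝ) :
    μ.real (X ⁻¹' Set.uIoc a b) ≤ L * |b - a| := by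
  have h1 := h.map_apply_le (measurableSet_uIoc : MeasurableSet (Set.uIoc a b))
  rw [Measure.map_apply hX measurableSet_uIoc, Real.volume_uIoc, ← ENNReal.ofReal_mul hL] at h1
  exact ENNReal.toReal_le_of_le_ofReal (by positivity) h1

/-- A bounded density keeps the noise away from `0`, so its first moment cannot be small. -/
lemma HasDensityBoundedBy.one_le_mul_of_integral_abs_le [IsProbabilityMeasure μ] {X : Ω → ℝ}
    {L σ : ℝ} (hL : 0 < L) (h : HasDensityBoundedBy X μ L) (hX : Measurable X)
    (hint : Integrable X μ) (hσ : ∫ ω, |X ω| ∂μ ≤ σ) : 1 ≤ 8 * (L * σ) := by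
  -- The interval of length `1 / (2 L)` around `0` has mass at most `1 / 2`.
  have h1 := h.measureReal_uIoc_le hL.le hX (-(1 / (4 * L))) (1 / (4 * L))
  have h2 : L * |1 / (4 * L) - -(1 / (4 * L))| = 1 / 2 := by
    rw [abs_of_pos (by rw [sub_neg_eq_add]; positivity)]
    field_simp
    norm_num
  rw [h2] at h1
  have hm : MeasurableSet (X ⁻¹' Set.uIoc (-(1 / (4 * L))) (1 / (4 * L))) :=
    hX measurableSet_uIoc
  have h3 := measureReal_compl (μ := μ) hm
  rw [probReal_univ] at h3
  have h4 := mul_meas_ge_le_integral_of_nonneg (μ := μ) (f := fun ω => |X ω|)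
    (Filter.Eventually.of_forall fun ω => abs_nonneg _) hint.abs (1 / (4 * L))
  have h5 : μ.real (X ⁻¹' Set.uIoc (-(1 / (4 * L))) (1 / (4 * L)))ᶜ
      ≤ μ.real {ω | 1 / (4 * L) ≤ |X ω|} := by
    refine measureReal_mono fun ω hω => ?_
    by_contra hlt
    refine hω ?_
    have h6 := abs_lt.1 (not_le.1 (show ¬ 1 / (4 * L) ≤ |X ω| from hlt))
    exact Set.mem_uIoc.2 (Or.inl ⟨h6.1, h6.2.le⟩)
  have h7 : 1 / (4 * L) * (1 / 2) ≤ σ :=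
    (mul_le_mul_of_nonneg_left (by linarith) (by positivity)).trans (h4.trans hσ)
  have h8 : 8 * L * (1 / (4 * L) * (1 / 2)) ≤ 8 * L * σ :=
    mul_le_mul_of_nonneg_left h7 (by positivity)
  have h9 : 8 * L * (1 / (4 * L) * (1 / 2)) = 1 := by field_simp; norm_num
  linarith

lemma integrable_mul_stepDiff {X Y : Ω → ℝ} (hX : Integrable X μ) (hY : Measurable Y) (δ : ℝ) :
    Integrable (fun ω => X ω * stepDiff δ (Y ω)) μ :=
  hX.mul_bdd (c := 1) ((measurable_stepDiff δ).comp hY).aestronglyMeasurable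
    (Filter.Eventually.of_forall fun ω => abs_stepDiff_le δ (Y ω))

lemma integral_mul_stepDiff_le [IsProbabilityMeasure μ] {X : Ω → ℝ} {L σ : ℝ} (hL : 0 ≤ L)
    (hX : Measurable X) (hint : Integrable X μ) (hd : HasDensityBoundedBy X μ L)
    (hσ : ∫ ω, |X ω| ∂μ ≤ σ) (δ : ℝ) :
    ∫ ω, X ω * stepDiff δ (X ω) ∂μ ≤ min (L * δ ^ 2) σ := by
  have hi := integrable_mul_stepDiff hint hX δ
  refine le_min ?_ ?_
  · have hm : MeasurableSet (X ⁻¹' Set.uIoc 0 δ) := hX measurableSet_uIoc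
    calc ∫ ω, X ω * stepDiff δ (X ω) ∂μ
        ≤ ∫ ω, |δ| * (X ⁻¹' Set.uIoc 0 δ).indicator 1 ω ∂μ := by
          refine integral_mono hi ?_ fun ω => mul_stepDiff_le δ (X ω)
          exact ((integrable_indicator_iff hm).2
            (integrable_const (1 : ℝ)).integrableOn).const_mul _
      _ = |δ| * μ.real (X ⁻¹' Set.uIoc 0 δ) := by
          rw [integral_const_mul, integral_indicator_one hm]
      _ ≤ |δ| * (L * |δ - 0|) :=
          mul_le_mul_of_nonneg_left (hd.measureReal_uIoc_le hL hX 0 δ) (abs_nonneg _)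
      _ = L * δ ^ 2 := by rw [sub_zero, ← sq_abs]; ring
  · refine (integral_mono hi hint.abs fun ω => ?_).trans hσ
    refine (le_abs_self _).trans ?_
    rw [abs_mul]
    exact mul_le_of_le_one_right (abs_nonneg _) (abs_stepDiff_le _ _)

lemma integrable_gain {D ξ ζ : Ω → ℝ} (hD : AEMeasurable D μ) (hξ : Integrable ξ μ)
    (hζ : Integrable ζ μ) : Integrable (fun ω => gain (D ω) (ξ ω) (ζ ω)) μ := by
  refine (hξ.abs.add hζ.abs).mono'
    (measurable_gain.comp_aemeasurable (hD.prodMk (hξ.1.aemeasurable.prodMk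
      hζ.1.aemeasurable))).aestronglyMeasurable ?_
  refine Filter.Eventually.of_forall fun ω => ?_
  rw [Real.norm_of_nonneg (gain_nonneg _ _ _)]
  exact gain_le_abs_add_abs _ _ _

/-- The cross terms `E[ξ s(ζ)]` vanish because the noises are independent and centred; what is
left is `E[ξ s(ξ)] + E[ζ s(ζ)]`. -/
lemma integral_gain_zero_sub_gain_le [IsProbabilityMeasure μ] {ξ ζ : Ω → ℝ} {L σ : ℝ} (hL : 0 ≤ L)
    (hξm : Measurable ξ) (hζm : Measurable ζ) (hξi : Integrable ξ μ) (hζi : Integrable ζ μ)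
    (hind : IndepFun ξ ζ μ)
    (hξd : HasDensityBoundedBy ξ μ L) (hζd : HasDensityBoundedBy ζ μ L)
    (hξσ : ∫ ω, |ξ ω| ∂μ ≤ σ) (hζσ : ∫ ω, |ζ ω| ∂μ ≤ σ)
    (hξ0 : ∫ ω, ξ ω ∂μ = 0) (hζ0 : ∫ ω, ζ ω ∂μ = 0) (δ : ℝ) :
    ∫ ω, (gain 0 (ξ ω) (ζ ω) - gain δ (ξ ω) (ζ ω)) ∂μ ≤ 2 * min (L * δ ^ 2) σ := by
  have h1 := integrable_mul_stepDiff hξi hξm δ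
  have h2 := integrable_mul_stepDiff hζi hζm δ
  have h3 := integrable_mul_stepDiff hξi hζm δ
  have h4 := integrable_mul_stepDiff hζi hξm δ
  have hc1 : ∫ ω, ξ ω * stepDiff δ (ζ ω) ∂μ = 0 := by
    have := (hind.comp measurable_id (measurable_stepDiff δ)).integral_fun_mul_eq_mul_integral
      hξm.aestronglyMeasurable ((measurable_stepDiff δ).comp hζm).aestronglyMeasurable
    simp only [Function.comp_apply, id] at this
    rw [this, hξ0, zero_mul]
  have hc2 : ∫ ω, ζ ω * stepDiff δ (ξ ω) ∂μ = 0 := by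
    have := (hind.symm.comp measurable_id (measurable_stepDiff δ)).integral_fun_mul_eq_mul_integral
      hζm.aestronglyMeasurable ((measurable_stepDiff δ).comp hξm).aestronglyMeasurable
    simp only [Function.comp_apply, id] at this
    rw [this, hζ0, zero_mul]
  have hle : ∫ ω, (gain 0 (ξ ω) (ζ ω) - gain δ (ξ ω) (ζ ω)) ∂μ
      ≤ ∫ ω, ((ξ ω * stepDiff δ (ξ ω) + ζ ω * stepDiff δ (ζ ω))
        - (ξ ω * stepDiff δ (ζ ω) + ζ ω * stepDiff δ (ξ ω))) ∂μ := by
    refine integral_mono_ae ((integrable_gain aemeasurable_const hξi hζi).sub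
      (integrable_gain aemeasurable_const hξi hζi)) ((h1.add h2).sub (h3.add h4)) ?_
    filter_upwards [hξd.ae_ne_zero hξm, hζd.ae_ne_zero hζm] with ω hv hw
    refine (gain_zero_sub_gain_le hv hw δ).trans (le_of_eq ?_)
    ring
  have e1 : ∫ ω, ((ξ ω * stepDiff δ (ξ ω) + ζ ω * stepDiff δ (ζ ω))
        - (ξ ω * stepDiff δ (ζ ω) + ζ ω * stepDiff δ (ξ ω))) ∂μ
      = (∫ ω, ξ ω * stepDiff δ (ξ ω) ∂μ) + ∫ ω, ζ ω * stepDiff δ (ζ ω) ∂μ := by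
    have e2 := integral_sub (h1.add h2) (h3.add h4)
    simp only [Pi.add_apply] at e2
    rw [e2, integral_add h1 h2, integral_add h3 h4, hc1, hc2]
    ring
  have h5 := integral_mul_stepDiff_le hL hξm hξi hξd hξσ δ
  have h6 := integral_mul_stepDiff_le hL hζm hζi hζd hζσ δ
  linarith

/-- The same bound for a random error `D` that is independent of the noises of the round. -/
lemma integral_gain_zero_sub_gain_random_le [IsProbabilityMeasure μ] {D ξ ζ : Ω → ℝ} {L σ : ℝ}
    (hL : 0 ≤ L) (hσ0 : 0 ≤ σ) (hD : Measurable D)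
    (hξm : Measurable ξ) (hζm : Measurable ζ) (hξi : Integrable ξ μ) (hζi : Integrable ζ μ)
    (hDind : IndepFun D (fun ω => (ξ ω, ζ ω)) μ) (hind : IndepFun ξ ζ μ)
    (hξd : HasDensityBoundedBy ξ μ L) (hζd : HasDensityBoundedBy ζ μ L)
    (hξσ : ∫ ω, |ξ ω| ∂μ ≤ σ) (hζσ : ∫ ω, |ζ ω| ∂μ ≤ σ)
    (hξ0 : ∫ ω, ξ ω ∂μ = 0) (hζ0 : ∫ ω, ζ ω ∂μ = 0) :
    ∫ ω, (gain 0 (ξ ω) (ζ ω) - gain (D ω) (ξ ω) (ζ ω)) ∂μ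
      ≤ ∫ ω, 2 * min (L * D ω ^ 2) σ ∂μ := by
  have hN : Measurable fun ω => (ξ ω, ζ ω) := hξm.prodMk hζm
  let F : ℝ × ℝ × ℝ → ℝ := fun q => gain 0 q.2.1 q.2.2 - gain q.1 q.2.1 q.2.2
  have hF : Measurable F :=
    (measurable_gain.comp (measurable_const.prodMk measurable_snd)).sub measurable_gain
  have hmap := hDind.map_prod_eq_prod_map_map hD.aemeasurable hN.aemeasurable
  have hFi : Integrable F (μ.map fun ω => (D ω, ξ ω, ζ ω)) :=
    (integrable_map_measure hF.aestronglyMeasurable (hD.prodMk hN).aemeasurable).2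
      ((integrable_gain aemeasurable_const hξi hζi).sub (integrable_gain hD.aemeasurable hξi hζi))
  have hprob : IsProbabilityMeasure (μ.map fun ω => (ξ ω, ζ ω)) :=
    Measure.isProbabilityMeasure_map hN.aemeasurable
  have hprobD : IsProbabilityMeasure (μ.map D) := Measure.isProbabilityMeasure_map hD.aemeasurable
  rw [hmap] at hFi
  have e1 : ∫ ω, (gain 0 (ξ ω) (ζ ω) - gain (D ω) (ξ ω) (ζ ω)) ∂μ
      = ∫ δ, (∫ y, F (δ, y) ∂(μ.map fun ω => (ξ ω, ζ ω))) ∂(μ.map D) := by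
    rw [← integral_prod F hFi, ← hmap,
      integral_map (hD.prodMk hN).aemeasurable hF.aestronglyMeasurable]
  have hmin : Measurable fun δ : ℝ => 2 * min (L * δ ^ 2) σ := by fun_prop
  rw [e1, ← integral_map (f := fun δ : ℝ => 2 * min (L * δ ^ 2) σ) hD.aemeasurable
    hmin.aestronglyMeasurable]
  refine integral_mono hFi.integral_prod_left ?_ fun δ => ?_
  · refine Integrable.of_bound (C := 2 * σ) hmin.aestronglyMeasurable
      (Filter.Eventually.of_forall fun δ => ?_)
    rw [Real.norm_of_nonneg (by positivity)]
    exact mul_le_mul_of_nonneg_left (min_le_right _ _) zero_le_two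
  · rw [integral_map hN.aemeasurable
      (f := fun y => F (δ, y)) (hF.comp measurable_prodMk_left).aestronglyMeasurable]
    exact integral_gain_zero_sub_gain_le hL hξm hζm hξi hζi hind hξd hζd hξσ hζσ hξ0 hζ0 δ

end

/-! ### Moments and truncation -/

section

variable {Ω : Type*} [MeasurableSpace Ω] {μ : Measure Ω}

lemma eLpNorm_le_of_lintegral_rpow_le {X : Ω → ℝ} {p σ : ℝ} (hp : 0 < p) (hσ : 0 ≤ σ)
    (h : ∫⁻ ω, ENNReal.ofReal (|X ω| ^ p) ∂μ ≤ ENNReal.ofReal (σ ^ p)) :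
    eLpNorm X (ENNReal.ofReal p) μ ≤ ENNReal.ofReal σ := by
  rw [eLpNorm_eq_lintegral_rpow_enorm_toReal (by simpa using hp) ENNReal.ofReal_ne_top,
    ENNReal.toReal_ofReal hp.le]
  have e : ∀ ω, ‖X ω‖ₑ ^ p = ENNReal.ofReal (|X ω| ^ p) := fun ω => by
    rw [Real.enorm_eq_ofReal_abs, ENNReal.ofReal_rpow_of_nonneg (abs_nonneg _) hp.le]
  simp_rw [e]
  calc (∫⁻ ω, ENNReal.ofReal (|X ω| ^ p) ∂μ) ^ (1 / p)
      ≤ (ENNReal.ofReal (σ ^ p)) ^ (1 / p) := ENNReal.rpow_le_rpow h (by positivity)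
    _ = ENNReal.ofReal σ := by
      rw [ENNReal.ofReal_rpow_of_nonneg (by positivity) (by positivity), ← Real.rpow_mul hσ,
        mul_one_div_cancel hp.ne', Real.rpow_one]

lemma integral_abs_rpow_le_of_eLpNorm_le {X : Ω → ℝ} {p M : ℝ} (hp : 0 < p) (hM : 0 ≤ M)
    (hX : AEStronglyMeasurable X μ) (h : eLpNorm X (ENNReal.ofReal p) μ ≤ ENNReal.ofReal M) :
    Integrable (fun ω => |X ω| ^ p) μ ∧ ∫ ω, |X ω| ^ p ∂μ ≤ M ^ p := by
  have hmem : MemLp X (ENNReal.ofReal p) μ := ⟨hX, h.trans_lt ENNReal.ofReal_lt_top⟩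
  have hp0 : ENNReal.ofReal p ≠ 0 := by simpa using hp
  have hi := hmem.integrable_norm_rpow hp0 ENNReal.ofReal_ne_top
  rw [hmem.eLpNorm_eq_integral_rpow_norm hp0 ENNReal.ofReal_ne_top] at h
  rw [ENNReal.toReal_ofReal hp.le] at h hi
  simp only [Real.norm_eq_abs] at h hi
  refine ⟨hi, ?_⟩
  have h0 : 0 ≤ ∫ ω, |X ω| ^ p ∂μ := integral_nonneg fun ω => by positivity
  have h1 : (∫ ω, |X ω| ^ p ∂μ) ^ p⁻¹ ≤ M := (ENNReal.ofReal_le_ofReal_iff hM).1 h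
  calc ∫ ω, |X ω| ^ p ∂μ = ((∫ ω, |X ω| ^ p ∂μ) ^ p⁻¹) ^ p := by
        rw [← Real.rpow_mul h0, inv_mul_cancel₀ hp.ne', Real.rpow_one]
    _ ≤ M ^ p := Real.rpow_le_rpow (by positivity) h1 hp.le

lemma integrable_and_integral_abs_le [IsProbabilityMeasure μ] {X : Ω → ℝ} {p M : ℝ}
    (hp : 1 ≤ p) (hM : 0 ≤ M) (hX : AEStronglyMeasurable X μ)
    (h : eLpNorm X (ENNReal.ofReal p) μ ≤ ENNReal.ofReal M) :
    Integrable X μ ∧ ∫ ω, |X ω| ∂μ ≤ M := by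
  have h1 : eLpNorm X (ENNReal.ofReal 1) μ ≤ ENNReal.ofReal M :=
    (eLpNorm_le_eLpNorm_of_exponent_le (ENNReal.ofReal_le_ofReal hp) hX).trans h
  refine ⟨memLp_one_iff_integrable.1 ⟨hX, ?_⟩, ?_⟩
  · rw [← ENNReal.ofReal_one]
    exact h1.trans_lt ENNReal.ofReal_lt_top
  · simpa using (integral_abs_rpow_le_of_eLpNorm_le one_pos hM hX h1).2

/-- The truncation of a real number at level `τ`. -/
noncomputable def trunc (τ u : ℝ) : ℝ := if |u| ≤ τ then u else 0

lemma measurable_trunc (τ : ℝ) : Measurable (trunc τ) :=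
  Measurable.ite (measurableSet_le (by fun_prop) measurable_const) measurable_id measurable_const

lemma abs_trunc_le {τ : ℝ} (hτ : 0 ≤ τ) (u : ℝ) : |trunc τ u| ≤ τ := by
  unfold trunc
  split_ifs with h
  · exact h
  · simpa using hτ

lemma abs_trunc_sub_le {τ p : ℝ} (hτ : 0 < τ) (hp : 1 ≤ p) (u : ℝ) :
    |trunc τ u - u| ≤ τ * (|u| ^ p / τ ^ p) := by
  unfold trunc
  split_ifs with h
  · simp only [sub_self, abs_zero]
    positivity
  · have h1 : 1 ≤ |u| / τ := (one_le_div hτ).2 (not_le.1 h).le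
    rw [zero_sub, abs_neg, ← Real.div_rpow (abs_nonneg _) hτ.le]
    calc |u| = τ * (|u| / τ) := by field_simp
      _ ≤ τ * (|u| / τ) ^ p :=
        mul_le_mul_of_nonneg_left (Real.self_le_rpow_of_one_le h1 hp) hτ.le

lemma trunc_sq_le {τ p : ℝ} (hτ : 0 < τ) (hp0 : 0 ≤ p) (hp : p ≤ 2) (u : ℝ) :
    trunc τ u ^ 2 ≤ τ ^ 2 * (|u| ^ p / τ ^ p) := by
  unfold trunc
  split_ifs with h
  · have h1 : |u| / τ ≤ 1 := (div_le_one hτ).2 h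
    rw [← Real.div_rpow (abs_nonneg _) hτ.le]
    calc u ^ 2 = τ ^ 2 * (|u| / τ) ^ (2 : ℝ) := by
          rw [Real.rpow_two, div_pow, sq_abs]
          field_simp
      _ ≤ τ ^ 2 * (|u| / τ) ^ p := by
        refine mul_le_mul_of_nonneg_left ?_ (by positivity)
        exact Real.rpow_le_rpow_of_exponent_ge' (by positivity) h1 hp0 hp
  · rw [zero_pow two_ne_zero]
    positivity

lemma abs_integral_trunc_sub_le {U : Ω → ℝ} {τ p u : ℝ} [IsFiniteMeasure μ]
    (hτ : 0 < τ) (hp : 1 ≤ p) (hU : Integrable U μ)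
    (hUp : Integrable (fun ω => |U ω| ^ p) μ) (hu : ∫ ω, |U ω| ^ p ∂μ ≤ u) :
    |∫ ω, trunc τ (U ω) ∂μ - ∫ ω, U ω ∂μ| ≤ τ * (u / τ ^ p) := by
  have hti : Integrable (fun ω => trunc τ (U ω)) μ :=
    Integrable.of_bound (C := τ)
      ((measurable_trunc τ).comp_aemeasurable hU.1.aemeasurable).aestronglyMeasurable
      (Filter.Eventually.of_forall fun ω => abs_trunc_le hτ.le (U ω))
  rw [← integral_sub hti hU]
  calc |∫ ω, (trunc τ (U ω) - U ω) ∂μ| ≤ ∫ ω, |trunc τ (U ω) - U ω| ∂μ :=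
        abs_integral_le_integral_abs
    _ ≤ ∫ ω, τ * (|U ω| ^ p / τ ^ p) ∂μ :=
        integral_mono (hti.sub hU).abs ((hUp.div_const _).const_mul _)
          fun ω => abs_trunc_sub_le hτ hp (U ω)
    _ = τ * ((∫ ω, |U ω| ^ p ∂μ) / τ ^ p) := by rw [integral_const_mul, integral_div]
    _ ≤ τ * (u / τ ^ p) := by gcongr

lemma integral_trunc_sq_le {U : Ω → ℝ} {τ p u : ℝ} (hτ : 0 < τ) (hp0 : 0 ≤ p)
    (hp : p ≤ 2) (hUp : Integrable (fun ω => |U ω| ^ p) μ) (hu : ∫ ω, |U ω| ^ p ∂μ ≤ u) :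
    ∫ ω, trunc τ (U ω) ^ 2 ∂μ ≤ τ ^ 2 * (u / τ ^ p) := by
  calc ∫ ω, trunc τ (U ω) ^ 2 ∂μ ≤ ∫ ω, τ ^ 2 * (|U ω| ^ p / τ ^ p) ∂μ :=
        integral_mono_of_nonneg (Filter.Eventually.of_forall fun ω => sq_nonneg _)
          ((hUp.div_const _).const_mul _)
          (Filter.Eventually.of_forall fun ω => trunc_sq_le hτ hp0 hp (U ω))
    _ = τ ^ 2 * ((∫ ω, |U ω| ^ p ∂μ) / τ ^ p) := by rw [integral_const_mul, integral_div]
    _ ≤ τ ^ 2 * (u / τ ^ p) := by gcongr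

/-! ### Empirical means of independent variables -/

lemma memLp_mean {n : ℕ} {Y : Fin n → Ω → ℝ} (hY : ∀ s, MemLp (Y s) 2 μ) :
    MemLp (fun ω => (n : ℝ)⁻¹ * ∑ s, Y s ω) 2 μ :=
  (memLp_finsetSum _ fun s _ => hY s).const_mul _

lemma integrable_mean_sub_sq [IsFiniteMeasure μ] {n : ℕ} {Y : Fin n → Ω → ℝ}
    (hY : ∀ s, MemLp (Y s) 2 μ) (c : ℝ) :
    Integrable (fun ω => ((n : ℝ)⁻¹ * ∑ s, Y s ω - c) ^ 2) μ :=
  ((memLp_mean hY).sub (memLp_const c)).integrable_sq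

/-- Mean squared error of an empirical mean: variance plus squared bias. -/
lemma integral_mean_sub_sq_le [IsProbabilityMeasure μ] {n : ℕ} (hn : 0 < n)
    {Y : Fin n → Ω → ℝ} (hY : ∀ s, MemLp (Y s) 2 μ)
    (hind : Pairwise fun s t => IndepFun (Y s) (Y t) μ) {c b : ℝ}
    (hb : ∀ s, |∫ ω, Y s ω ∂μ - c| ≤ b) :
    ∫ ω, ((n : ℝ)⁻¹ * ∑ s, Y s ω - c) ^ 2 ∂μ
      ≤ (n : ℝ)⁻¹ ^ 2 * ∑ s, ∫ ω, Y s ω ^ 2 ∂μ + b ^ 2 := by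
  have hn' : (0 : ℝ) < n := by exact_mod_cast hn
  have hmem := memLp_mean hY
  have hZ : MemLp (fun ω => (n : ℝ)⁻¹ * ∑ s, Y s ω - c) 2 μ := hmem.sub (memLp_const c)
  have hsum : ∫ ω, (n : ℝ)⁻¹ * ∑ s, Y s ω ∂μ = (n : ℝ)⁻¹ * ∑ s, ∫ ω, Y s ω ∂μ := by
    rw [integral_const_mul, integral_finsetSum _ fun s _ => (hY s).integrable one_le_two]
  have hv := variance_eq_sub hZ
  have hvar : variance (fun ω => (n : ℝ)⁻¹ * ∑ s, Y s ω - c) μ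
      ≤ (n : ℝ)⁻¹ ^ 2 * ∑ s, ∫ ω, Y s ω ^ 2 ∂μ := by
    have e1 : variance (fun ω => (n : ℝ)⁻¹ * ∑ s, Y s ω - c) μ
        = variance (fun ω => (n : ℝ)⁻¹ * ∑ s, Y s ω) μ :=
      variance_sub_const hmem.1 c
    have e2 : (fun ω => ∑ s, Y s ω) = ∑ s, Y s := by ext; simp
    rw [e1, variance_const_mul, e2, IndepFun.variance_sum (fun s _ => hY s)
      fun s _ t _ hst => hind hst]
    refine mul_le_mul_of_nonneg_left (Finset.sum_le_sum fun s _ => ?_) (by positivity)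
    exact variance_le_expectation_sq (hY s).1
  have hmean : ∫ ω, ((n : ℝ)⁻¹ * ∑ s, Y s ω - c) ∂μ
      = (n : ℝ)⁻¹ * ∑ s, (∫ ω, Y s ω ∂μ - c) := by
    rw [integral_sub (hmem.integrable one_le_two) (integrable_const c), hsum]
    simp only [integral_const, probReal_univ, one_smul, Finset.sum_sub_distrib, Finset.sum_const,
      Finset.card_univ, Fintype.card_fin, nsmul_eq_mul]
    field_simp
  have hbias : (∫ ω, ((n : ℝ)⁻¹ * ∑ s, Y s ω - c) ∂μ) ^ 2 ≤ b ^ 2 := by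
    rw [hmean]
    refine sq_le_sq' (neg_le_of_abs_le ?_) (le_of_abs_le ?_) <;>
    · rw [abs_mul, abs_of_pos (inv_pos.2 hn'), inv_mul_le_iff₀ hn']
      refine (Finset.abs_sum_le_sum_abs _ _).trans ?_
      refine (Finset.sum_le_sum fun s _ => hb s).trans ?_
      simp
  simp only [Pi.pow_apply] at hv
  linarith

end

/-! ### Perturbation of the normal equations -/

/-- If `G` is within `lam / 2` of `S` in Frobenius norm and `S ⪰ lam I`, then `G ⪰ (lam / 2) I`. -/
lemma half_mul_sum_sq_le_of_frobenius_le {d : ℕ} {S G : Matrix (Fin d) (Fin d) ℝ} {lam : ℝ}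
    (hlam : 0 ≤ lam) (hS : (S - lam • (1 : Matrix (Fin d) (Fin d) ℝ)).PosSemidef)
    (hG : ∑ i, ∑ j, (G i j - S i j) ^ 2 ≤ lam ^ 2 / 4) (v : Fin d → ℝ) :
    lam / 2 * ∑ i, v i ^ 2 ≤ ∑ i, v i * G.mulVec v i := by
  have h1 : lam * ∑ i, v i ^ 2 ≤ ∑ i, v i * S.mulVec v i := by
    have h := hS.dotProduct_mulVec_nonneg v
    simp only [Matrix.sub_mulVec, Matrix.smul_mulVec, Matrix.one_mulVec, dotProduct,
      star_trivial, Pi.sub_apply, Pi.smul_apply, smul_eq_mul, mul_sub, Finset.sum_sub_distrib] at h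
    rw [Finset.mul_sum]
    have e : ∑ i, v i * (lam * v i) = ∑ i, lam * v i ^ 2 :=
      Finset.sum_congr rfl fun i _ => by ring
    linarith
  have h2 : ∑ i, v i * G.mulVec v i - ∑ i, v i * S.mulVec v i
      = ∑ q : Fin d × Fin d, (G q.1 q.2 - S q.1 q.2) * (v q.1 * v q.2) := by
    rw [Fintype.sum_prod_type, ← Finset.sum_sub_distrib]
    refine Finset.sum_congr rfl fun i _ => ?_
    simp only [Matrix.mulVec, dotProduct]
    rw [← mul_sub, ← Finset.sum_sub_distrib, Finset.mul_sum]
    exact Finset.sum_congr rfl fun j _ => by ring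
  have h3 := Finset.sum_mul_sq_le_sq_mul_sq Finset.univ
    (fun q : Fin d × Fin d => G q.1 q.2 - S q.1 q.2) (fun q => v q.1 * v q.2)
  have h4 : ∑ q : Fin d × Fin d, (v q.1 * v q.2) ^ 2 = (∑ i, v i ^ 2) ^ 2 := by
    rw [Fintype.sum_prod_type, sq (∑ i, v i ^ 2), Finset.sum_mul_sum]
    simp only [mul_pow]
  rw [h4, ← h2, Fintype.sum_prod_type] at h3
  have h5 : 0 ≤ ∑ i, v i ^ 2 := Finset.sum_nonneg fun i _ => sq_nonneg _
  have h6 : (∑ i, v i * G.mulVec v i - ∑ i, v i * S.mulVec v i) ^ 2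
      ≤ (lam / 2 * ∑ i, v i ^ 2) ^ 2 := by
    refine h3.trans ((mul_le_mul_of_nonneg_right hG (sq_nonneg _)).trans (le_of_eq ?_))
    ring
  have h7 := (abs_le_of_sq_le_sq' h6 (by positivity)).1
  linarith

/-- The error of the solution of `G a = b` is at most `2 / lam` times the residual. -/
lemma sum_sq_inv_mulVec_sub_le {d : ℕ} {G : Matrix (Fin d) (Fin d) ℝ} {lam : ℝ} (hlam : 0 < lam)
    (hG : ∀ v : Fin d → ℝ, lam / 2 * ∑ i, v i ^ 2 ≤ ∑ i, v i * G.mulVec v i)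
    (b φ : Fin d → ℝ) :
    ∑ i, (G⁻¹.mulVec b i - φ i) ^ 2 ≤ 4 / lam ^ 2 * ∑ i, (b i - G.mulVec φ i) ^ 2 := by
  have hdet : IsUnit G.det := by
    rw [isUnit_iff_ne_zero]
    intro h0
    obtain ⟨v, hv, hv0⟩ := Matrix.exists_mulVec_eq_zero_iff.2 h0
    have h1 := hG v
    rw [hv0] at h1
    simp only [Pi.zero_apply, mul_zero, Finset.sum_const_zero] at h1
    have h2 : ∑ i, v i ^ 2 = 0 :=
      le_antisymm (nonpos_of_mul_nonpos_right h1 (by positivity))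
        (Finset.sum_nonneg fun i _ => sq_nonneg _)
    rw [Finset.sum_eq_zero_iff_of_nonneg fun i _ => sq_nonneg _] at h2
    exact hv (funext fun i => pow_eq_zero_iff two_ne_zero |>.1 (h2 i (Finset.mem_univ i)))
  -- The error `e = G⁻¹ b - φ` solves `G e = b - G φ`; test this equation with `e`.
  set e : Fin d → ℝ := fun i => G⁻¹.mulVec b i - φ i
  have hr : G.mulVec e = fun i => b i - G.mulVec φ i := by
    have : e = G⁻¹.mulVec b - φ := rfl
    rw [this, Matrix.mulVec_sub, Matrix.mulVec_mulVec, Matrix.mul_nonsing_inv _ hdet,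
      Matrix.one_mulVec]
    rfl
  have h1 := hG e
  have h2 := Finset.sum_mul_sq_le_sq_mul_sq Finset.univ e (G.mulVec e)
  have hE : 0 ≤ ∑ i, e i ^ 2 := Finset.sum_nonneg fun i _ => sq_nonneg _
  have h3 : (lam / 2 * ∑ i, e i ^ 2) ^ 2 ≤ (∑ i, e i ^ 2) * ∑ i, G.mulVec e i ^ 2 :=
    (pow_le_pow_left₀ (by positivity) h1 2).trans h2
  simp only [hr] at h3
  change ∑ i, e i ^ 2 ≤ _
  rcases hE.eq_or_lt with h0 | h0
  · rw [← h0]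
    positivity
  · have h4 : lam ^ 2 / 4 * ∑ i, e i ^ 2 ≤ ∑ i, (b i - G.mulVec φ i) ^ 2 := by
      refine le_of_mul_le_mul_left ?_ h0
      calc _ = (lam / 2 * ∑ i, e i ^ 2) ^ 2 := by ring
        _ ≤ _ := h3
    calc ∑ i, e i ^ 2 = 4 / lam ^ 2 * (lam ^ 2 / 4 * ∑ i, e i ^ 2) := by field_simp
      _ ≤ _ := mul_le_mul_of_nonneg_left h4 (by positivity)

/-- A pathwise bound that needs no event on which the Gram matrix is well conditioned: if the Gram
matrix `G` is more than `lam / 2` away from `S`, then already the second term exceeds `σ`. -/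
lemma min_le_residual_add_frobenius {d : ℕ} {S G : Matrix (Fin d) (Fin d) ℝ} {lam L σ δ : ℝ}
    (hlam : 0 < lam) (hL : 0 ≤ L) (hσ : 0 ≤ σ)
    (hS : (S - lam • (1 : Matrix (Fin d) (Fin d) ℝ)).PosSemidef) (b φ : Fin d → ℝ)
    (hδ : δ ^ 2 ≤ ∑ i, (G⁻¹.mulVec b i - φ i) ^ 2) :
    min (L * δ ^ 2) σ ≤ 4 / lam ^ 2 * (L * ∑ i, (b i - G.mulVec φ i) ^ 2
      + σ * ∑ i, ∑ j, (G i j - S i j) ^ 2) := by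
  have hR : 0 ≤ ∑ i, (b i - G.mulVec φ i) ^ 2 := Finset.sum_nonneg fun i _ => sq_nonneg _
  have hQ : 0 ≤ ∑ i, ∑ j, (G i j - S i j) ^ 2 :=
    Finset.sum_nonneg fun i _ => Finset.sum_nonneg fun j _ => sq_nonneg _
  by_cases hG : ∑ i, ∑ j, (G i j - S i j) ^ 2 ≤ lam ^ 2 / 4
  · have h1 := sum_sq_inv_mulVec_sub_le hlam (half_mul_sum_sq_le_of_frobenius_le hlam.le hS hG) b φ
    calc min (L * δ ^ 2) σ ≤ L * δ ^ 2 := min_le_left _ _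
      _ ≤ L * (4 / lam ^ 2 * ∑ i, (b i - G.mulVec φ i) ^ 2) :=
        mul_le_mul_of_nonneg_left (hδ.trans h1) hL
      _ = 4 / lam ^ 2 * (L * ∑ i, (b i - G.mulVec φ i) ^ 2) := by ring
      _ ≤ _ := by gcongr; exact le_add_of_nonneg_right (by positivity)
  · calc min (L * δ ^ 2) σ ≤ σ := min_le_right _ _
      _ = 4 / lam ^ 2 * (σ * (lam ^ 2 / 4)) := by field_simp
      _ ≤ 4 / lam ^ 2 * (σ * ∑ i, ∑ j, (G i j - S i j) ^ 2) := by gcongr; exact (not_le.1 hG).le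
      _ ≤ _ := by gcongr; exact le_add_of_nonneg_left (by positivity)

/-! ### Measurability of the algorithm -/

lemma measurable_apply {d : ℕ} (j : Fin d) : Measurable fun x : Context d => x j := by fun_prop

lemma measurable_marketValue {d : ℕ} (φ : Context d) : Measurable (marketValue φ) := by
  unfold marketValue
  fun_prop

lemma abs_apply_le_norm {d : ℕ} (x : Context d) (j : Fin d) : |x j| ≤ ‖x‖ := by
  simpa using PiLp.norm_apply_le x j

lemma abs_marketValue_le {d : ℕ} (φ x : Context d) : |marketValue φ x| ≤ ‖φ‖ * ‖x‖ := by
  have h : marketValue φ x = inner ℝ φ x := by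
    simp [marketValue, PiLp.inner_apply]
  rw [h]
  exact abs_real_inner_le_norm _ _

lemma measurable_score {d : ℕ} (j : Fin d) : Measurable fun o : Obs d => score o j := by
  unfold score
  fun_prop

lemma truncatedMean_eq {d n : ℕ} (τ : ℝ) (sample : Fin n → Obs d) (j : Fin d) :
    truncatedMean τ sample j = (n : ℝ)⁻¹ * ∑ s, trunc τ (score (sample s) j) := rfl

lemma gram_mulVec {d n : ℕ} (sample : Fin n → Obs d) (φ : Context d) (j : Fin d) :
    (gram sample).mulVec (fun i => φ i) j
      = (n : ℝ)⁻¹ * ∑ s, (sample s).1 j * marketValue φ (sample s).1 := by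
  simp only [Matrix.mulVec, dotProduct, gram, Matrix.of_apply, marketValue]
  simp_rw [mul_assoc, ← Finset.mul_sum, Finset.sum_mul, Finset.mul_sum]
  rw [Finset.sum_comm]
  simp only [mul_assoc]

lemma measurable_estimate {d n : ℕ} (T : ℕ) (p B σ : ℝ) (j : Fin d) :
    Measurable fun sample : Fin n → Obs d => estimate T p B σ sample j := by
  have hg : Continuous fun sample : Fin n → Obs d => gram sample := by
    refine continuous_matrix fun i j => ?_
    simp only [gram, Matrix.of_apply]
    fun_prop
  have hinv : ∀ i k, Measurable fun sample : Fin n → Obs d => (gram sample)⁻¹ i k := by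
    intro i k
    simp only [Matrix.inv_def, Ring.inverse_eq_inv', Matrix.smul_apply, smul_eq_mul]
    exact hg.matrix_det.measurable.inv.mul (hg.matrix_adjugate.matrix_elem i k).measurable
  simp only [estimate, Matrix.mulVec, dotProduct, truncatedMean_eq]
  refine Finset.measurable_fun_sum _ fun k _ => (hinv j k).mul ?_
  refine (Finset.measurable_fun_sum _ fun s _ => ?_).const_mul _
  exact (measurable_trunc _).comp ((measurable_score k).comp (measurable_pi_apply s))

lemma measurable_epochPolicy (d T : ℕ) (p B σ π₀ : ℝ) (t : ℕ) :
    Measurable fun q : (Finset.Ico 1 t → Obs d) × Context d =>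
      epochPolicy d T p B σ π₀ t q.1 q.2 := by
  unfold epochPolicy
  by_cases ht : 2 ≤ t
  · simp only [ht, dite_true]
    refine Finset.measurable_fun_sum _ fun j _ =>
      ((measurable_apply j).comp measurable_snd).mul ((measurable_estimate T p B σ j).comp ?_)
    exact measurable_pi_iff.2 fun i => (measurable_pi_apply _).comp measurable_fst
  · simp only [ht, dite_false]
    exact measurable_const

/-! ### The market -/

/-- If `X` and `N` are independent and jointly independent of `H`, then `N` is independent of
`(H, X)`. -/
lemma indepFun_prodMk_of_indepFun {Ω α β γ : Type*} [MeasurableSpace Ω] [MeasurableSpace α]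
    [MeasurableSpace β] [MeasurableSpace γ] {μ : Measure Ω} [IsProbabilityMeasure μ]
    {H : Ω → α} {X : Ω → β} {N : Ω → γ} (hH : Measurable H) (hX : Measurable X)
    (hN : Measurable N) (h : IndepFun H (fun ω => (X ω, N ω)) μ) (hXN : IndepFun X N μ) :
    IndepFun (fun ω => (H ω, X ω)) N μ := by
  have h1 := Measure.isProbabilityMeasure_map (μ := μ) hH.aemeasurable
  have h2 := Measure.isProbabilityMeasure_map (μ := μ) hX.aemeasurable
  have h3 := Measure.isProbabilityMeasure_map (μ := μ) hN.aemeasurable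
  have hHX : IndepFun H X μ := h.comp measurable_id measurable_fst
  rw [indepFun_iff_map_prod_eq_prod_map_map (hH.prodMk hX).aemeasurable hN.aemeasurable,
    hHX.map_prod_eq_prod_map_map hH.aemeasurable hX.aemeasurable]
  have e := h.map_prod_eq_prod_map_map hH.aemeasurable (hX.prodMk hN).aemeasurable
  rw [hXN.map_prod_eq_prod_map_map hX.aemeasurable hN.aemeasurable, ← Measure.prodAssoc_prod] at e
  refine (MeasurableEquiv.prodAssoc (α := α) (β := β) (γ := γ)).map_measurableEquiv_injective ?_
  rw [← e, Measure.map_map MeasurableEquiv.prodAssoc.measurable ((hH.prodMk hX).prodMk hN)]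
  rfl

/-- The observation `(x, V, W)` of a round with context and noises `q = (x, ξ, ζ)`. -/
def toObs {d : ℕ} (φ : Context d) (q : Context d × ℝ × ℝ) : Obs d :=
  (q.1, marketValue φ q.1 + q.2.1, marketValue φ q.1 + q.2.2)

lemma measurable_toObs {d : ℕ} (φ : Context d) : Measurable (toObs φ) := by
  have := measurable_marketValue φ
  unfold toObs
  fun_prop

lemma score_eq {d : ℕ} (φ x : Context d) (v w : ℝ) (j : Fin d) :
    score (toObs φ (x, v, w)) j
      = x j * (marketValue φ (x) + (2 : ℝ)⁻¹ * (v + w)) := by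
  simp only [score, toObs]
  ring

/-- The standing assumptions on parameters, contexts and noises; they do not mention the horizon
or the algorithm. -/
structure Market {Ω : Type*} [MeasurableSpace Ω] (μ : Measure Ω) {d : ℕ} (p L B σ lam : ℝ)
    (φ : Context d) (x : ℕ → Ω → Context d) (ξ ζ : ℕ → Ω → ℝ) : Prop where
  one_lt_p : 1 < p
  p_le_two : p ≤ 2
  one_le_d : 1 ≤ d
  one_le_L : 1 ≤ L
  B_pos : 0 < B
  σ_pos : 0 < σ
  lam_pos : 0 < lam
  norm_φ_le : ‖φ‖ ≤ B
  measurable_x : ∀ t, Measurable (x t)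
  measurable_ξ : ∀ t, Measurable (ξ t)
  measurable_ζ : ∀ t, Measurable (ζ t)
  indep : iIndepFun (fun t ω => (x t ω, ξ t ω, ζ t ω)) μ
  indep_x : ∀ t, IndepFun (x t) (fun ω => (ξ t ω, ζ t ω)) μ
  indep_noise : ∀ t, IndepFun (ξ t) (ζ t) μ
  identDistrib : ∀ t, IdentDistrib (x t) (x 1) μ μ
  norm_x_le : ∀ t, ∀ᵐ ω ∂μ, ‖x t ω‖ ≤ 1
  posSemidef : (secondMoment (x 1) μ - lam • (1 : Matrix (Fin d) (Fin d) ℝ)).PosSemidef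
  density_ξ : ∀ t, HasDensityBoundedBy (ξ t) μ L
  density_ζ : ∀ t, HasDensityBoundedBy (ζ t) μ L
  moment_ξ : ∀ t, ∫⁻ ω, ENNReal.ofReal (|ξ t ω| ^ p) ∂μ ≤ ENNReal.ofReal (σ ^ p)
  moment_ζ : ∀ t, ∫⁻ ω, ENNReal.ofReal (|ζ t ω| ^ p) ∂μ ≤ ENNReal.ofReal (σ ^ p)
  mean_ξ : ∀ t, ∫ ω, ξ t ω ∂μ = 0
  mean_ζ : ∀ t, ∫ ω, ζ t ω ∂μ = 0

namespace Market

variable {Ω : Type*} [MeasurableSpace Ω] {μ : Measure Ω} {d : ℕ}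
  {p L B σ lam : ℝ} {φ : Context d} {x : ℕ → Ω → Context d} {ξ ζ : ℕ → Ω → ℝ}

lemma eLpNorm_ξ_le (h : Market μ p L B σ lam φ x ξ ζ) (t : ℕ) :
    eLpNorm (ξ t) (ENNReal.ofReal p) μ ≤ ENNReal.ofReal σ :=
  eLpNorm_le_of_lintegral_rpow_le (zero_lt_one.trans h.one_lt_p) h.σ_pos.le (h.moment_ξ t)

lemma eLpNorm_ζ_le (h : Market μ p L B σ lam φ x ξ ζ) (t : ℕ) :
    eLpNorm (ζ t) (ENNReal.ofReal p) μ ≤ ENNReal.ofReal σ :=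
  eLpNorm_le_of_lintegral_rpow_le (zero_lt_one.trans h.one_lt_p) h.σ_pos.le (h.moment_ζ t)

lemma ae_abs_x_le (h : Market μ p L B σ lam φ x ξ ζ) (t : ℕ) :
    ∀ᵐ ω ∂μ, ∀ j, |x t ω j| ≤ 1 := by
  filter_upwards [h.norm_x_le t] with ω hω j using (abs_apply_le_norm _ j).trans hω

lemma ae_abs_marketValue_le (h : Market μ p L B σ lam φ x ξ ζ) (t : ℕ) :
    ∀ᵐ ω ∂μ, |marketValue φ (x t ω)| ≤ B := by
  filter_upwards [h.norm_x_le t] with ω hω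
  refine (abs_marketValue_le _ _).trans ?_
  calc ‖φ‖ * ‖x t ω‖ ≤ B * 1 := mul_le_mul h.norm_φ_le hω (norm_nonneg _) h.B_pos.le
    _ = B := mul_one B

lemma ae_abs_x_mul_marketValue_le (h : Market μ p L B σ lam φ x ξ ζ) (t : ℕ) (j : Fin d) :
    ∀ᵐ ω ∂μ, |x t ω j * marketValue φ (x t ω)| ≤ B := by
  filter_upwards [h.ae_abs_x_le t, h.ae_abs_marketValue_le t] with ω h1 h2
  rw [abs_mul]
  exact (mul_le_of_le_one_left (abs_nonneg _) (h1 j)).trans h2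

lemma measurable_x_apply (h : Market μ p L B σ lam φ x ξ ζ) (t : ℕ) (j : Fin d) :
    Measurable fun ω => x t ω j := (measurable_apply j).comp (h.measurable_x t)

lemma measurable_marketValue_x (h : Market μ p L B σ lam φ x ξ ζ) (t : ℕ) :
    Measurable fun ω => marketValue φ (x t ω) := (measurable_marketValue φ).comp (h.measurable_x t)

lemma measurable_score_toObs (h : Market μ p L B σ lam φ x ξ ζ) (t : ℕ) (j : Fin d) :
    Measurable fun ω => score (toObs φ (x t ω, ξ t ω, ζ t ω)) j :=
  (measurable_score j).comp ((measurable_toObs φ).comp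
    ((h.measurable_x t).prodMk ((h.measurable_ξ t).prodMk (h.measurable_ζ t))))

lemma integral_x_mul_x (h : Market μ p L B σ lam φ x ξ ζ) (t : ℕ) (i j : Fin d) :
    ∫ ω, x t ω i * x t ω j ∂μ = secondMoment (x 1) μ i j :=
  ((h.identDistrib t).comp (u := fun y : Context d => y i * y j)
    ((measurable_apply i).mul (measurable_apply j))).integral_eq

lemma indepFun_comp (h : Market μ p L B σ lam φ x ξ ζ) {n : ℕ} {a : Fin n → ℕ}
    (ha : Function.Injective a) {f : Context d × ℝ × ℝ → ℝ} (hf : Measurable f) :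
    Pairwise fun s t => IndepFun (fun ω => f (x (a s) ω, ξ (a s) ω, ζ (a s) ω))
      (fun ω => f (x (a t) ω, ξ (a t) ω, ζ (a t) ω)) μ :=
  fun _ _ hst => (h.indep.indepFun (ha.ne hst)).comp hf hf

variable [IsProbabilityMeasure μ]

lemma integrable_ξ (h : Market μ p L B σ lam φ x ξ ζ) (t : ℕ) : Integrable (ξ t) μ :=
  (integrable_and_integral_abs_le h.one_lt_p.le h.σ_pos.le (h.measurable_ξ t).aestronglyMeasurable
    (h.eLpNorm_ξ_le t)).1

lemma integrable_ζ (h : Market μ p L B σ lam φ x ξ ζ) (t : ℕ) : Integrable (ζ t) μ :=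
  (integrable_and_integral_abs_le h.one_lt_p.le h.σ_pos.le (h.measurable_ζ t).aestronglyMeasurable
    (h.eLpNorm_ζ_le t)).1

lemma integral_abs_ξ_le (h : Market μ p L B σ lam φ x ξ ζ) (t : ℕ) : ∫ ω, |ξ t ω| ∂μ ≤ σ :=
  (integrable_and_integral_abs_le h.one_lt_p.le h.σ_pos.le (h.measurable_ξ t).aestronglyMeasurable
    (h.eLpNorm_ξ_le t)).2

lemma integral_abs_ζ_le (h : Market μ p L B σ lam φ x ξ ζ) (t : ℕ) : ∫ ω, |ζ t ω| ∂μ ≤ σ :=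
  (integrable_and_integral_abs_le h.one_lt_p.le h.σ_pos.le (h.measurable_ζ t).aestronglyMeasurable
    (h.eLpNorm_ζ_le t)).2

lemma one_le_mul_σ (h : Market μ p L B σ lam φ x ξ ζ) : 1 ≤ 8 * (L * σ) :=
  (h.density_ξ 1).one_le_mul_of_integral_abs_le (zero_lt_one.trans_le h.one_le_L)
    (h.measurable_ξ 1) (h.integrable_ξ 1) (h.integral_abs_ξ_le 1)

/-! ### The scores -/

/-- Minkowski's inequality: the context has norm at most `1`, the market value is at most `B`, and
the averaged noise has `p`-norm at most `σ`. -/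
lemma eLpNorm_score_le (h : Market μ p L B σ lam φ x ξ ζ) (t : ℕ) (j : Fin d) :
    eLpNorm (fun ω => score (toObs φ (x t ω, ξ t ω, ζ t ω)) j) (ENNReal.ofReal p) μ
      ≤ ENNReal.ofReal (B + σ) := by
  have hp : 1 ≤ ENNReal.ofReal p := by
    rw [← ENNReal.ofReal_one]
    exact ENNReal.ofReal_le_ofReal h.one_lt_p.le
  have hm := (h.measurable_marketValue_x t).aestronglyMeasurable (μ := μ)
  have hξ := (h.measurable_ξ t).aestronglyMeasurable (μ := μ)
  have hζ := (h.measurable_ζ t).aestronglyMeasurable (μ := μ)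
  have h1 : eLpNorm (fun ω => score (toObs φ (x t ω, ξ t ω, ζ t ω)) j) (ENNReal.ofReal p) μ
      ≤ eLpNorm ((fun ω => marketValue φ (x t ω)) + (2 : ℝ)⁻¹ • (ξ t + ζ t))
        (ENNReal.ofReal p) μ := by
    refine eLpNorm_mono_ae ?_
    filter_upwards [h.ae_abs_x_le t] with ω hω
    rw [score_eq, norm_mul]
    exact mul_le_of_le_one_left (norm_nonneg _) (hω j)
  have h2 : eLpNorm (fun ω => marketValue φ (x t ω)) (ENNReal.ofReal p) μ ≤ ENNReal.ofReal B := by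
    have := eLpNorm_le_of_ae_bound (f := fun ω => marketValue φ (x t ω)) (p := ENNReal.ofReal p)
      (h.ae_abs_marketValue_le t)
    simpa using this
  have h3 : eLpNorm ((2 : ℝ)⁻¹ • (ξ t + ζ t)) (ENNReal.ofReal p) μ ≤ ENNReal.ofReal σ := by
    rw [eLpNorm_const_smul]
    have h4 : ‖(2 : ℝ)⁻¹‖ₑ = ENNReal.ofReal 2⁻¹ := by
      rw [Real.enorm_eq_ofReal_abs, abs_of_pos (by norm_num)]
    calc ‖(2 : ℝ)⁻¹‖ₑ * eLpNorm (ξ t + ζ t) (ENNReal.ofReal p) μ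
        ≤ ENNReal.ofReal 2⁻¹ * (ENNReal.ofReal σ + ENNReal.ofReal σ) := by
          rw [h4]
          gcongr
          exact (eLpNorm_add_le hξ hζ hp).trans (add_le_add (h.eLpNorm_ξ_le t) (h.eLpNorm_ζ_le t))
      _ = ENNReal.ofReal σ := by
          rw [← ENNReal.ofReal_add h.σ_pos.le h.σ_pos.le, ← ENNReal.ofReal_mul (by norm_num)]
          congr 1
          ring
  calc _ ≤ _ := h1
    _ ≤ _ := eLpNorm_add_le hm ((hξ.add hζ).const_smul _) hp
    _ ≤ _ := add_le_add h2 h3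
    _ = _ := (ENNReal.ofReal_add h.B_pos.le h.σ_pos.le).symm

lemma score_moment (h : Market μ p L B σ lam φ x ξ ζ) (t : ℕ) (j : Fin d) :
    Integrable (fun ω => |score (toObs φ (x t ω, ξ t ω, ζ t ω)) j| ^ p) μ ∧
      ∫ ω, |score (toObs φ (x t ω, ξ t ω, ζ t ω)) j| ^ p ∂μ ≤ (B + σ) ^ p :=
  integral_abs_rpow_le_of_eLpNorm_le (zero_lt_one.trans h.one_lt_p)
    (add_pos h.B_pos h.σ_pos).le (h.measurable_score_toObs t j).aestronglyMeasurable
    (h.eLpNorm_score_le t j)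

lemma integrable_score (h : Market μ p L B σ lam φ x ξ ζ) (t : ℕ) (j : Fin d) :
    Integrable (fun ω => score (toObs φ (x t ω, ξ t ω, ζ t ω)) j) μ :=
  (integrable_and_integral_abs_le h.one_lt_p.le (add_pos h.B_pos h.σ_pos).le
    (h.measurable_score_toObs t j).aestronglyMeasurable (h.eLpNorm_score_le t j)).1

lemma memLp_x_mul_x (h : Market μ p L B σ lam φ x ξ ζ) (t : ℕ) (i j : Fin d) :
    MemLp (fun ω => x t ω i * x t ω j) 2 μ := by
  refine MemLp.of_bound
    ((h.measurable_x_apply t i).mul (h.measurable_x_apply t j)).aestronglyMeasurable 1 ?_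
  filter_upwards [h.ae_abs_x_le t] with ω hω
  rw [norm_mul]
  exact mul_le_one₀ (hω i) (abs_nonneg _) (hω j)

lemma memLp_x_mul_marketValue (h : Market μ p L B σ lam φ x ξ ζ) (t : ℕ) (j : Fin d) :
    MemLp (fun ω => x t ω j * marketValue φ (x t ω)) 2 μ :=
  MemLp.of_bound ((h.measurable_x_apply t j).mul
    (h.measurable_marketValue_x t)).aestronglyMeasurable B (h.ae_abs_x_mul_marketValue_le t j)

lemma integral_x_mul_marketValue (h : Market μ p L B σ lam φ x ξ ζ) (t : ℕ) (j : Fin d) :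
    ∫ ω, x t ω j * marketValue φ (x t ω) ∂μ
      = (secondMoment (x 1) μ).mulVec (fun i => φ i) j := by
  simp only [marketValue, Finset.mul_sum, Matrix.mulVec, dotProduct, ← mul_assoc]
  rw [integral_finsetSum _ fun i _ =>
    ((h.memLp_x_mul_x t j i).integrable one_le_two).mul_const _]
  refine Finset.sum_congr rfl fun i _ => ?_
  rw [integral_mul_const, h.integral_x_mul_x]

/-- The noises average out: the mean of the score vector is `E[x xᵀ] φ`. -/
lemma integral_score (h : Market μ p L B σ lam φ x ξ ζ) (t : ℕ) (j : Fin d) :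
    ∫ ω, score (toObs φ (x t ω, ξ t ω, ζ t ω)) j ∂μ
      = (secondMoment (x 1) μ).mulVec (fun i => φ i) j := by
  have hx := (h.measurable_x_apply t j).aestronglyMeasurable (μ := μ)
  have hb : ∀ᵐ ω ∂μ, ‖x t ω j‖ ≤ 1 := by
    filter_upwards [h.ae_abs_x_le t] with ω hω using hω j
  have i1 : Integrable (fun ω => x t ω j * ξ t ω) μ := (h.integrable_ξ t).bdd_mul hx hb
  have i2 : Integrable (fun ω => x t ω j * ζ t ω) μ := (h.integrable_ζ t).bdd_mul hx hb
  have i3 : Integrable (fun ω => (2 : ℝ)⁻¹ * (x t ω j * ξ t ω + x t ω j * ζ t ω)) μ :=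
    (i1.add i2).const_mul _
  have e1 : ∫ ω, x t ω j * ξ t ω ∂μ = 0 := by
    have := IndepFun.integral_fun_mul_eq_mul_integral
      ((h.indep_x t).comp (measurable_apply j) measurable_fst)
      hx (h.measurable_ξ t).aestronglyMeasurable
    simp only [Function.comp_apply] at this
    rw [this, h.mean_ξ, mul_zero]
  have e2 : ∫ ω, x t ω j * ζ t ω ∂μ = 0 := by
    have := IndepFun.integral_fun_mul_eq_mul_integral
      ((h.indep_x t).comp (measurable_apply j) measurable_snd)
      hx (h.measurable_ζ t).aestronglyMeasurable
    simp only [Function.comp_apply] at this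
    rw [this, h.mean_ζ, mul_zero]
  have e3 : ∀ ω, score (toObs φ (x t ω, ξ t ω, ζ t ω)) j = x t ω j * marketValue φ (x t ω)
      + (2 : ℝ)⁻¹ * (x t ω j * ξ t ω + x t ω j * ζ t ω) := fun ω => by
    rw [score_eq]
    ring
  simp_rw [e3]
  rw [integral_add ((h.memLp_x_mul_marketValue t j).integrable one_le_two) i3,
    integral_const_mul, integral_add i1 i2, e1, e2, h.integral_x_mul_marketValue]
  ring

/-! ### Errors of the estimates from an epoch -/

lemma memLp_trunc_score (h : Market μ p L B σ lam φ x ξ ζ) {τ : ℝ} (hτ : 0 ≤ τ) (t : ℕ)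
    (j : Fin d) : MemLp (fun ω => trunc τ (score (toObs φ (x t ω, ξ t ω, ζ t ω)) j)) 2 μ :=
  MemLp.of_bound ((measurable_trunc τ).comp (h.measurable_score_toObs t j)).aestronglyMeasurable τ
    (Filter.Eventually.of_forall fun _ => abs_trunc_le hτ _)

lemma integrable_truncatedMean_sub_sq (h : Market μ p L B σ lam φ x ξ ζ) {n : ℕ} (a : Fin n → ℕ)
    {τ : ℝ} (hτ : 0 ≤ τ) (c : ℝ) (j : Fin d) :
    Integrable (fun ω => (truncatedMean τ
      (fun s => toObs φ (x (a s) ω, ξ (a s) ω, ζ (a s) ω)) j - c) ^ 2) μ :=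
  integrable_mean_sub_sq (fun s => h.memLp_trunc_score hτ (a s) j) c

lemma integral_truncatedMean_sub_sq_le (h : Market μ p L B σ lam φ x ξ ζ) {n : ℕ} (hn : 0 < n)
    {a : Fin n → ℕ} (ha : Function.Injective a) {τ ρ : ℝ} (hτ : 0 < τ)
    (hρ : (B + σ) ^ p / τ ^ p = ρ) (j : Fin d) :
    ∫ ω, (truncatedMean τ (fun s => toObs φ (x (a s) ω, ξ (a s) ω, ζ (a s) ω)) j
      - (secondMoment (x 1) μ).mulVec (fun i => φ i) j) ^ 2 ∂μ
      ≤ (n : ℝ)⁻¹ * (τ ^ 2 * ρ) + (τ * ρ) ^ 2 := by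
  have hn' : (0 : ℝ) < n := by exact_mod_cast hn
  have hb : ∀ s, |∫ ω, trunc τ (score (toObs φ (x (a s) ω, ξ (a s) ω, ζ (a s) ω)) j) ∂μ
      - (secondMoment (x 1) μ).mulVec (fun i => φ i) j| ≤ τ * ρ := fun s => by
    rw [← h.integral_score (a s) j, ← hρ]
    exact abs_integral_trunc_sub_le hτ h.one_lt_p.le (h.integrable_score (a s) j)
      (h.score_moment (a s) j).1 (h.score_moment (a s) j).2
  refine (integral_mean_sub_sq_le hn (fun s => h.memLp_trunc_score hτ.le (a s) j)
    (h.indepFun_comp ha ((measurable_trunc τ).comp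
      ((measurable_score j).comp (measurable_toObs φ)))) hb).trans ?_
  refine add_le_add_left ?_ _
  calc (n : ℝ)⁻¹ ^ 2 * ∑ s,
        ∫ ω, trunc τ (score (toObs φ (x (a s) ω, ξ (a s) ω, ζ (a s) ω)) j) ^ 2 ∂μ
      ≤ (n : ℝ)⁻¹ ^ 2 * ∑ _s : Fin n, τ ^ 2 * ρ := by
        refine mul_le_mul_of_nonneg_left (Finset.sum_le_sum fun s _ => ?_) (by positivity)
        rw [← hρ]
        exact integral_trunc_sq_le hτ (zero_le_one.trans h.one_lt_p.le) h.p_le_two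
          (h.score_moment (a s) j).1 (h.score_moment (a s) j).2
    _ = (n : ℝ)⁻¹ * (τ ^ 2 * ρ) := by
        simp only [Finset.sum_const, Finset.card_univ, Fintype.card_fin, nsmul_eq_mul]
        field_simp

lemma integrable_gram_mulVec_sub_sq (h : Market μ p L B σ lam φ x ξ ζ) {n : ℕ} (a : Fin n → ℕ)
    (c : ℝ) (j : Fin d) :
    Integrable (fun ω => ((gram fun s => toObs φ (x (a s) ω, ξ (a s) ω, ζ (a s) ω)).mulVec
      (fun i => φ i) j - c) ^ 2) μ := by
  simp only [gram_mulVec]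
  exact integrable_mean_sub_sq (fun s => h.memLp_x_mul_marketValue (a s) j) c

lemma integral_gram_mulVec_sub_sq_le (h : Market μ p L B σ lam φ x ξ ζ) {n : ℕ} (hn : 0 < n)
    {a : Fin n → ℕ} (ha : Function.Injective a) (j : Fin d) :
    ∫ ω, ((gram fun s => toObs φ (x (a s) ω, ξ (a s) ω, ζ (a s) ω)).mulVec (fun i => φ i) j
      - (secondMoment (x 1) μ).mulVec (fun i => φ i) j) ^ 2 ∂μ ≤ (n : ℝ)⁻¹ * B ^ 2 := by
  have hn' : (0 : ℝ) < n := by exact_mod_cast hn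
  simp only [gram_mulVec]
  have hb : ∀ s, |∫ ω, x (a s) ω j * marketValue φ (x (a s) ω) ∂μ
      - (secondMoment (x 1) μ).mulVec (fun i => φ i) j| ≤ 0 := fun s => by
    rw [h.integral_x_mul_marketValue, sub_self, abs_zero]
  have hf : Measurable fun q : Context d × ℝ × ℝ => q.1 j * marketValue φ q.1 :=
    ((measurable_apply j).mul (measurable_marketValue φ)).comp measurable_fst
  refine (integral_mean_sub_sq_le hn (fun s => h.memLp_x_mul_marketValue (a s) j)
    (h.indepFun_comp ha hf) hb).trans ?_
  calc (n : ℝ)⁻¹ ^ 2 * ∑ s, ∫ ω, (x (a s) ω j * marketValue φ (x (a s) ω)) ^ 2 ∂μ + 0 ^ 2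
      ≤ (n : ℝ)⁻¹ ^ 2 * ∑ _s : Fin n, B ^ 2 := by
        rw [zero_pow two_ne_zero, add_zero]
        refine mul_le_mul_of_nonneg_left (Finset.sum_le_sum fun s _ => ?_) (by positivity)
        have hle : ∀ᵐ ω ∂μ, (x (a s) ω j * marketValue φ (x (a s) ω)) ^ 2 ≤ B ^ 2 := by
          filter_upwards [h.ae_abs_x_mul_marketValue_le (a s) j] with ω hω
          exact sq_le_sq' (neg_le_of_abs_le hω) (le_of_abs_le hω)
        refine (integral_mono_ae (h.memLp_x_mul_marketValue (a s) j).integrable_sq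
          (integrable_const _) hle).trans ?_
        simp
    _ = (n : ℝ)⁻¹ * B ^ 2 := by
        simp only [Finset.sum_const, Finset.card_univ, Fintype.card_fin, nsmul_eq_mul]
        field_simp

lemma integrable_gram_sub_sq (h : Market μ p L B σ lam φ x ξ ζ) {n : ℕ} (a : Fin n → ℕ)
    (c : ℝ) (i j : Fin d) :
    Integrable (fun ω =>
      ((gram fun s => toObs φ (x (a s) ω, ξ (a s) ω, ζ (a s) ω)) i j - c) ^ 2) μ :=
  integrable_mean_sub_sq (fun s => h.memLp_x_mul_x (a s) i j) c

/-- The Gram matrix concentrates in Frobenius norm, without dependence on the dimension, because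
`‖x xᵀ‖ = ‖x‖² ≤ 1`. -/
lemma integral_frobenius_gram_sub_le (h : Market μ p L B σ lam φ x ξ ζ) {n : ℕ} (hn : 0 < n)
    {a : Fin n → ℕ} (ha : Function.Injective a) :
    ∫ ω, ∑ i, ∑ j, ((gram fun s => toObs φ (x (a s) ω, ξ (a s) ω, ζ (a s) ω)) i j
      - secondMoment (x 1) μ i j) ^ 2 ∂μ ≤ (n : ℝ)⁻¹ := by
  have hn' : (0 : ℝ) < n := by exact_mod_cast hn
  have hsq : ∀ t i j, Integrable (fun ω => (x t ω i * x t ω j) ^ 2) μ := fun t i j =>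
    (h.memLp_x_mul_x t i j).integrable_sq
  have hentry : ∀ i j, ∫ ω, ((gram fun s => toObs φ (x (a s) ω, ξ (a s) ω, ζ (a s) ω)) i j
      - secondMoment (x 1) μ i j) ^ 2 ∂μ
      ≤ (n : ℝ)⁻¹ ^ 2 * ∑ s, ∫ ω, (x (a s) ω i * x (a s) ω j) ^ 2 ∂μ := fun i j => by
    have hb : ∀ s, |∫ ω, x (a s) ω i * x (a s) ω j ∂μ - secondMoment (x 1) μ i j| ≤ 0 :=
      fun s => by rw [h.integral_x_mul_x, sub_self, abs_zero]
    have hf : Measurable fun q : Context d × ℝ × ℝ => q.1 i * q.1 j :=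
      ((measurable_apply i).mul (measurable_apply j)).comp measurable_fst
    have := integral_mean_sub_sq_le hn (fun s => h.memLp_x_mul_x (a s) i j)
      (h.indepFun_comp ha hf) hb
    rw [zero_pow two_ne_zero, add_zero] at this
    exact this
  have hsum : ∀ t, ∑ i, ∑ j, ∫ ω, (x t ω i * x t ω j) ^ 2 ∂μ ≤ 1 := fun t => by
    have e : ∑ i, ∑ j, ∫ ω, (x t ω i * x t ω j) ^ 2 ∂μ
        = ∫ ω, ∑ i, ∑ j, (x t ω i * x t ω j) ^ 2 ∂μ := by
      rw [integral_finsetSum _ fun i _ => integrable_finsetSum _ fun j _ => hsq t i j]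
      exact Finset.sum_congr rfl fun i _ => (integral_finsetSum _ fun j _ => hsq t i j).symm
    rw [e]
    have hle : ∀ᵐ ω ∂μ, ∑ i, ∑ j, (x t ω i * x t ω j) ^ 2 ≤ 1 := by
      filter_upwards [h.norm_x_le t] with ω hω
      have h1 : ∑ i, x t ω i ^ 2 ≤ 1 := by
        rw [← EuclideanSpace.real_norm_sq_eq]
        exact pow_le_one₀ (norm_nonneg _) hω
      simp_rw [mul_pow]
      rw [← Finset.sum_mul_sum]
      exact mul_le_one₀ h1 (Finset.sum_nonneg fun i _ => sq_nonneg _) h1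
    refine (integral_mono_ae (integrable_finsetSum _ fun i _ => integrable_finsetSum _
      fun j _ => hsq t i j) (integrable_const _) hle).trans ?_
    simp
  refine (integral_finsetSum _ fun i _ => integrable_finsetSum _
    fun j _ => h.integrable_gram_sub_sq a _ i j).trans_le ?_
  calc _ ≤ ∑ i, ∑ j, (n : ℝ)⁻¹ ^ 2 * ∑ s, ∫ ω, (x (a s) ω i * x (a s) ω j) ^ 2 ∂μ := by
        refine Finset.sum_le_sum fun i _ => ?_
        refine (integral_finsetSum _ fun j _ => h.integrable_gram_sub_sq a _ i j).trans_le ?_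
        exact Finset.sum_le_sum fun j _ => hentry i j
    _ = (n : ℝ)⁻¹ ^ 2 * ∑ s, ∑ i, ∑ j, ∫ ω, (x (a s) ω i * x (a s) ω j) ^ 2 ∂μ := by
        rw [Finset.sum_comm (s := (Finset.univ : Finset (Fin n)))]
        simp_rw [← Finset.mul_sum]
        congr 1
        exact Finset.sum_congr rfl fun i _ => Finset.sum_comm
    _ ≤ (n : ℝ)⁻¹ ^ 2 * ∑ _s : Fin n, 1 :=
        mul_le_mul_of_nonneg_left (Finset.sum_le_sum fun s _ => hsum (a s)) (by positivity)
    _ = (n : ℝ)⁻¹ := by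
        simp only [Finset.sum_const, Finset.card_univ, Fintype.card_fin, nsmul_eq_mul]
        field_simp

/-- Expected pricing error, cut off at `σ`, when the price `xᵀ φ̂` uses an estimate from `n`
rounds: variance and bias of the truncated means, plus the error of the Gram matrix. -/
lemma integral_min_sq_le (h : Market μ p L B σ lam φ x ξ ζ) {n : ℕ} (hn : 0 < n)
    {a : Fin n → ℕ} (ha : Function.Injective a) {τ ρ : ℝ} (hτ : 0 < τ)
    (hρ : (B + σ) ^ p / τ ^ p = ρ) {D : Ω → ℝ}
    (hD : ∀ᵐ ω ∂μ, D ω ^ 2 ≤ ∑ i, (((gram fun s =>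
      toObs φ (x (a s) ω, ξ (a s) ω, ζ (a s) ω))⁻¹).mulVec
        (truncatedMean τ fun s => toObs φ (x (a s) ω, ξ (a s) ω, ζ (a s) ω)) i - φ i) ^ 2) :
    ∫ ω, min (L * D ω ^ 2) σ ∂μ
      ≤ 4 / lam ^ 2 * (L * (d * (2 * ((n : ℝ)⁻¹ * (τ ^ 2 * ρ) + (τ * ρ) ^ 2)
        + 2 * ((n : ℝ)⁻¹ * B ^ 2))) + σ * (n : ℝ)⁻¹) := by
  have hL : 0 ≤ L := zero_le_one.trans h.one_le_L
  set b : Ω → Fin d → ℝ := fun ω =>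
    truncatedMean τ fun s => toObs φ (x (a s) ω, ξ (a s) ω, ζ (a s) ω)
  set G : Ω → Matrix (Fin d) (Fin d) ℝ := fun ω =>
    gram fun s => toObs φ (x (a s) ω, ξ (a s) ω, ζ (a s) ω)
  set S := secondMoment (x 1) μ
  have i1 : ∀ j, Integrable (fun ω => (b ω j - S.mulVec (fun i => φ i) j) ^ 2) μ := fun j =>
    h.integrable_truncatedMean_sub_sq a hτ.le _ j
  have i2 : ∀ j, Integrable (fun ω =>
      ((G ω).mulVec (fun i => φ i) j - S.mulVec (fun i => φ i) j) ^ 2) μ := fun j =>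
    h.integrable_gram_mulVec_sub_sq a _ j
  have i5 : ∀ j, Integrable (fun ω => 2 * (b ω j - S.mulVec (fun i => φ i) j) ^ 2
      + 2 * ((G ω).mulVec (fun i => φ i) j - S.mulVec (fun i => φ i) j) ^ 2) μ := fun j =>
    ((i1 j).const_mul 2).add ((i2 j).const_mul 2)
  have i3 : Integrable (fun ω => ∑ j, (2 * (b ω j - S.mulVec (fun i => φ i) j) ^ 2
      + 2 * ((G ω).mulVec (fun i => φ i) j - S.mulVec (fun i => φ i) j) ^ 2)) μ :=
    integrable_finsetSum _ fun j _ => i5 j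
  have i4 : Integrable (fun ω => ∑ i, ∑ j, (G ω i j - S i j) ^ 2) μ :=
    integrable_finsetSum _ fun i _ => integrable_finsetSum _
      fun j _ => h.integrable_gram_sub_sq a _ i j
  have b3 : ∫ ω, ∑ j, (2 * (b ω j - S.mulVec (fun i => φ i) j) ^ 2
      + 2 * ((G ω).mulVec (fun i => φ i) j - S.mulVec (fun i => φ i) j) ^ 2) ∂μ
      ≤ d * (2 * ((n : ℝ)⁻¹ * (τ ^ 2 * ρ) + (τ * ρ) ^ 2) + 2 * ((n : ℝ)⁻¹ * B ^ 2)) := by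
    rw [integral_finsetSum _ fun j _ => i5 j]
    calc _ ≤ ∑ _j : Fin d, (2 * ((n : ℝ)⁻¹ * (τ ^ 2 * ρ) + (τ * ρ) ^ 2)
          + 2 * ((n : ℝ)⁻¹ * B ^ 2)) := by
          refine Finset.sum_le_sum fun j _ => ?_
          rw [integral_add ((i1 j).const_mul 2) ((i2 j).const_mul 2), integral_const_mul,
            integral_const_mul]
          exact add_le_add
            (mul_le_mul_of_nonneg_left (h.integral_truncatedMean_sub_sq_le hn ha hτ hρ j)
              zero_le_two)
            (mul_le_mul_of_nonneg_left (h.integral_gram_mulVec_sub_sq_le hn ha j) zero_le_two)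
      _ = _ := by rw [Finset.sum_const, Finset.card_univ, Fintype.card_fin, nsmul_eq_mul]
  calc ∫ ω, min (L * D ω ^ 2) σ ∂μ
      ≤ ∫ ω, 4 / lam ^ 2 * (L * ∑ j, (2 * (b ω j - S.mulVec (fun i => φ i) j) ^ 2
        + 2 * ((G ω).mulVec (fun i => φ i) j - S.mulVec (fun i => φ i) j) ^ 2)
        + σ * ∑ i, ∑ j, (G ω i j - S i j) ^ 2) ∂μ := by
        refine integral_mono_of_nonneg (Filter.Eventually.of_forall fun ω =>
          le_min (mul_nonneg hL (sq_nonneg _)) h.σ_pos.le)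
          (((i3.const_mul L).add (i4.const_mul σ)).const_mul _) ?_
        filter_upwards [hD] with ω hω
        refine (min_le_residual_add_frobenius h.lam_pos hL h.σ_pos.le h.posSemidef (b ω)
          (fun i => φ i) hω).trans ?_
        refine mul_le_mul_of_nonneg_left (add_le_add_left (mul_le_mul_of_nonneg_left
          (Finset.sum_le_sum fun j _ => ?_) hL) _) (by positivity)
        nlinarith [sq_nonneg ((b ω j - S.mulVec (fun i => φ i) j)
          + ((G ω).mulVec (fun i => φ i) j - S.mulVec (fun i => φ i) j))]
    _ = 4 / lam ^ 2 * (L * (∫ ω, ∑ j, (2 * (b ω j - S.mulVec (fun i => φ i) j) ^ 2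
        + 2 * ((G ω).mulVec (fun i => φ i) j - S.mulVec (fun i => φ i) j) ^ 2) ∂μ)
        + σ * ∫ ω, ∑ i, ∑ j, (G ω i j - S i j) ^ 2 ∂μ) := by
        rw [integral_const_mul, integral_add (i3.const_mul L) (i4.const_mul σ),
          integral_const_mul, integral_const_mul]
    _ ≤ _ := by
        refine mul_le_mul_of_nonneg_left (add_le_add (mul_le_mul_of_nonneg_left b3 hL)
          (mul_le_mul_of_nonneg_left (h.integral_frobenius_gram_sub_le hn ha) h.σ_pos.le))
          (by positivity)

end Market

/-! ### Rates -/

/-- An epoch ends before four times the length of the previous one. -/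
lemma le_four_mul_prevLength {t : ℕ} (ht : 2 ≤ t) : t ≤ 4 * prevLength t := by
  have h1 : 1 ≤ Nat.log 2 t := Nat.log_pos (by norm_num) ht
  have h2 : t < 2 ^ (Nat.log 2 t + 1) := Nat.lt_pow_succ_log_self (by norm_num) t
  have h3 : 2 ^ (Nat.log 2 t + 1) = 4 * prevLength t := by
    unfold prevLength
    obtain ⟨k, hk⟩ := Nat.exists_eq_add_of_le' h1
    rw [hk, Nat.add_sub_cancel]
    ring
  omega

lemma prevLength_pos (t : ℕ) : 0 < prevLength t := by
  unfold prevLength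
  positivity

/-- At the truncation level `τ` the bias `τ ρ` of a truncated mean is `M ρ ^ (1 - 1 / p)`, where
`ρ = ℓ / n`. -/
lemma truncation_rate {M p n l τ : ℝ} (hM : 0 < M) (hp : 1 < p) (hn : 0 < n) (hl : 0 < l)
    (hτ : τ = (M ^ p * n / l) ^ (1 / p)) :
    0 < τ ∧ M ^ p / τ ^ p = l / n ∧ (τ * (l / n)) ^ 2 = M ^ 2 * (l / n) ^ (2 - 2 / p) := by
  have hp0 : 0 < p := zero_lt_one.trans hp
  have hMp : 0 < M ^ p := Real.rpow_pos_of_pos hM p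
  have hρ : 0 < l / n := by positivity
  have e1 : τ = M * (l / n) ^ (-(1 / p)) := by
    have : M ^ p * n / l = M ^ p * (l / n)⁻¹ := by rw [inv_div]; ring
    rw [hτ, this, Real.mul_rpow hMp.le (by positivity), ← Real.rpow_mul hM.le,
      mul_one_div_cancel hp0.ne', Real.rpow_one, Real.inv_rpow hρ.le, Real.rpow_neg hρ.le]
  have hτ0 : 0 < τ := by
    rw [hτ]
    positivity
  refine ⟨hτ0, ?_, ?_⟩
  · rw [hτ, ← Real.rpow_mul (by positivity), one_div_mul_cancel hp0.ne', Real.rpow_one]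
    field_simp
  · rw [e1, mul_assoc, mul_pow]
    congr 1
    rw [← Real.rpow_natCast, Real.mul_rpow (by positivity) hρ.le, ← Real.rpow_mul hρ.le,
      ← Real.rpow_add hρ]
    congr 1
    push_cast
    ring

lemma inv_le_two_mul_rpow {n l a : ℝ} (hn : 1 ≤ n) (hl : 1 / 2 ≤ l) (ha0 : 0 ≤ a) (ha1 : a ≤ 1) :
    n⁻¹ ≤ 2 * (l / n) ^ a := by
  have hn0 : 0 < n := zero_lt_one.trans_le hn
  have h1 : 1 / 2 / n ≤ l / n := by gcongr
  have h2 : 1 / 2 / n ≤ 1 := by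
    rw [div_le_one hn0]
    linarith
  have h3 : 1 / 2 / n ≤ (l / n) ^ a :=
    calc 1 / 2 / n = (1 / 2 / n) ^ (1 : ℝ) := (Real.rpow_one _).symm
      _ ≤ (1 / 2 / n) ^ a := Real.rpow_le_rpow_of_exponent_ge (by positivity) h2 ha1
      _ ≤ (l / n) ^ a := Real.rpow_le_rpow (by positivity) h1 ha0
  calc n⁻¹ = 2 * (1 / 2 / n) := by field_simp
    _ ≤ _ := by gcongr

lemma rpow_div_le {n l t a : ℝ} (hn : 0 < n) (ht : 0 < t) (htn : t ≤ 4 * n) (hl : 0 ≤ l)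
    (ha0 : 0 ≤ a) (ha1 : a ≤ 1) : (l / n) ^ a ≤ 4 * (1 + l) * t ^ (-a) := by
  have h1 : l / n ≤ 4 * (1 + l) * t⁻¹ := by
    rw [← div_eq_mul_inv, div_le_div_iff₀ hn ht]
    nlinarith
  have h2 : (4 * (1 + l)) ^ a ≤ 4 * (1 + l) :=
    calc (4 * (1 + l)) ^ a ≤ (4 * (1 + l)) ^ (1 : ℝ) :=
          Real.rpow_le_rpow_of_exponent_le (by linarith) ha1
      _ = _ := Real.rpow_one _
  calc (l / n) ^ a ≤ (4 * (1 + l) * t⁻¹) ^ a := Real.rpow_le_rpow (by positivity) h1 ha0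
    _ = (4 * (1 + l)) ^ a * t ^ (-a) := by
        rw [Real.mul_rpow (by positivity) (by positivity), Real.inv_rpow ht.le,
          Real.rpow_neg ht.le]
    _ ≤ _ := by gcongr

/-- Comparison with the harmonic sum, which stays uniform as `a → 1`. -/
lemma sum_rpow_neg_le (T : ℕ) {a : ℝ} (ha1 : a ≤ 1) :
    ∑ t ∈ Finset.Icc 1 T, (t : ℝ) ^ (-a) ≤ (1 + Real.log T) * (T : ℝ) ^ (1 - a) := by
  have h1 : ∑ t ∈ Finset.Icc 1 T, (t : ℝ) ^ (-a)
      ≤ ∑ t ∈ Finset.Icc 1 T, (t : ℝ)⁻¹ * (T : ℝ) ^ (1 - a) := by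
    refine Finset.sum_le_sum fun t ht => ?_
    rw [Finset.mem_Icc] at ht
    have ht0 : (0 : ℝ) < t := by exact_mod_cast ht.1
    calc (t : ℝ) ^ (-a) = (t : ℝ)⁻¹ * (t : ℝ) ^ (1 - a) := by
          rw [← Real.rpow_neg_one, ← Real.rpow_add ht0]
          congr 1
          ring
      _ ≤ _ := by
          gcongr
          exact ht.2
  have h2 := harmonic_le_one_add_log T
  rw [harmonic_eq_sum_Icc] at h2
  push_cast at h2
  rw [← Finset.sum_mul] at h1
  exact h1.trans (mul_le_mul_of_nonneg_right h2 (by positivity))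

/-! ### The regret -/

lemma loss_eq {Ω : Type*} {d : ℕ} (A : Policy d) (φ : Context d) (x : ℕ → Ω → Context d)
    (ξ ζ : ℕ → Ω → ℝ) (t : ℕ) (ω : Ω) :
    loss A φ x ξ ζ t ω = gain 0 (ξ t ω) (ζ t ω)
      - gain (price A φ x ξ ζ t ω - marketValue φ (x t ω)) (ξ t ω) (ζ t ω) := by
  rw [← gain_add_left (marketValue φ (x t ω)) 0, ← gain_add_left (marketValue φ (x t ω))
    (price A φ x ξ ζ t ω - marketValue φ (x t ω)), add_zero, add_sub_cancel]
  rfl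

namespace Market

variable {Ω : Type*} [MeasurableSpace Ω] {μ : Measure Ω} {d : ℕ}
  {p L B σ lam : ℝ} {φ : Context d} {x : ℕ → Ω → Context d} {ξ ζ : ℕ → Ω → ℝ}

lemma measurable_price_sub (h : Market μ p L B σ lam φ x ξ ζ) (T : ℕ) (π₀ : ℝ) (t : ℕ) :
    Measurable fun ω =>
      price (epochPolicy d T p B σ π₀) φ x ξ ζ t ω - marketValue φ (x t ω) := by
  refine Measurable.sub ?_ (h.measurable_marketValue_x t)
  refine (measurable_epochPolicy d T p B σ π₀ t).comp ((measurable_pi_iff.2 fun s => ?_).prodMk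
    (h.measurable_x t))
  exact (measurable_toObs φ).comp
    ((h.measurable_x s).prodMk ((h.measurable_ξ s).prodMk (h.measurable_ζ s)))

lemma one_half_le_log (h : Market μ p L B σ lam φ x ξ ζ) {T : ℕ} (hT : 2 ≤ T) :
    1 / 2 ≤ Real.log (d * T) := by
  have hd : (1 : ℝ) ≤ d := by exact_mod_cast h.one_le_d
  have hT' : (2 : ℝ) ≤ T := by exact_mod_cast hT
  calc (1 / 2 : ℝ) ≤ Real.log 2 := by linarith [Real.log_two_gt_d9]
    _ ≤ Real.log (d * T) := Real.log_le_log zero_lt_two (by nlinarith)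

/-- From the second epoch on, the squared pricing error is at most that of the estimate `φ̂`. -/
lemma ae_price_sub_sq_le (h : Market μ p L B σ lam φ x ξ ζ) (T : ℕ) (π₀ : ℝ) {t : ℕ}
    (ht : 2 ≤ t) :
    ∀ᵐ ω ∂μ, (price (epochPolicy d T p B σ π₀) φ x ξ ζ t ω - marketValue φ (x t ω)) ^ 2
      ≤ ∑ i, (((gram fun s : Fin (prevLength t) => toObs φ (x (prevLength t + s) ω,
          ξ (prevLength t + s) ω, ζ (prevLength t + s) ω))⁻¹).mulVec
        (truncatedMean (truncationLevel d T p B σ (prevLength t)) fun s : Fin (prevLength t) =>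
          toObs φ (x (prevLength t + s) ω, ξ (prevLength t + s) ω, ζ (prevLength t + s) ω)) i
        - φ i) ^ 2 := by
  filter_upwards [h.norm_x_le t] with ω hω
  set e : Fin d → ℝ := ((gram fun s : Fin (prevLength t) => toObs φ (x (prevLength t + s) ω,
          ξ (prevLength t + s) ω, ζ (prevLength t + s) ω))⁻¹).mulVec
        (truncatedMean (truncationLevel d T p B σ (prevLength t)) fun s : Fin (prevLength t) =>
          toObs φ (x (prevLength t + s) ω, ξ (prevLength t + s) ω, ζ (prevLength t + s) ω))
  have hprice : price (epochPolicy d T p B σ π₀) φ x ξ ζ t ω = ∑ j, x t ω j * e j := by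
    simp only [price, epochPolicy, ht, dite_true]
    rfl
  have h1 : ∑ i, x t ω i ^ 2 ≤ 1 := by
    rw [← EuclideanSpace.real_norm_sq_eq]
    exact pow_le_one₀ (norm_nonneg _) hω
  rw [hprice, marketValue, ← Finset.sum_sub_distrib]
  simp_rw [← mul_sub]
  refine (Finset.sum_mul_sq_le_sq_mul_sq Finset.univ (fun i => x t ω i)
    fun i => e i - φ i).trans ?_
  exact mul_le_of_le_one_left (Finset.sum_nonneg fun i _ => sq_nonneg _) h1

variable [IsProbabilityMeasure μ]

/-- The price of a round depends on earlier rounds and on the context, hence not on the noises of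
the round. -/
lemma indepFun_price_sub (h : Market μ p L B σ lam φ x ξ ζ) (T : ℕ) (π₀ : ℝ) (t : ℕ) :
    IndepFun (fun ω => price (epochPolicy d T p B σ π₀) φ x ξ ζ t ω - marketValue φ (x t ω))
      (fun ω => (ξ t ω, ζ t ω)) μ := by
  have hm : ∀ s, Measurable fun ω => (x s ω, ξ s ω, ζ s ω) := fun s =>
    (h.measurable_x s).prodMk ((h.measurable_ξ s).prodMk (h.measurable_ζ s))
  have h1 := h.indep.indepFun_finset (Finset.Ico 1 t) {t} (by simp) hm
  have h2 : IndepFun (fun ω (s : Finset.Ico 1 t) => (x s ω, ξ s ω, ζ s ω))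
      (fun ω => (x t ω, ξ t ω, ζ t ω)) μ :=
    h1.comp measurable_id (measurable_pi_apply (⟨t, by simp⟩ : ({t} : Finset ℕ)))
  have hH : Measurable fun ω (s : Finset.Ico 1 t) => (x s ω, ξ s ω, ζ s ω) :=
    measurable_pi_iff.2 fun s => hm s
  have h3 : IndepFun (fun ω => ((fun s : Finset.Ico 1 t => (x s ω, ξ s ω, ζ s ω)), x t ω))
      (fun ω => (ξ t ω, ζ t ω)) μ :=
    indepFun_prodMk_of_indepFun hH (h.measurable_x t)
      ((h.measurable_ξ t).prodMk (h.measurable_ζ t)) h2 (h.indep_x t)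
  have hobs : Measurable fun q : (Finset.Ico 1 t → Context d × ℝ × ℝ) × Context d =>
      ((fun s => toObs φ (q.1 s)), q.2) :=
    (measurable_pi_iff.2 fun s => (measurable_toObs φ).comp
      ((measurable_pi_apply s).comp measurable_fst)).prodMk measurable_snd
  have hf := ((measurable_epochPolicy d T p B σ π₀ t).comp hobs).sub
    ((measurable_marketValue φ).comp measurable_snd)
  exact h3.comp hf measurable_id

lemma integrable_loss (h : Market μ p L B σ lam φ x ξ ζ) (T : ℕ) (π₀ : ℝ) (t : ℕ) :
    Integrable (loss (epochPolicy d T p B σ π₀) φ x ξ ζ t) μ := by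
  have := (integrable_gain (D := fun _ => 0) aemeasurable_const (h.integrable_ξ t)
    (h.integrable_ζ t)).sub (integrable_gain (h.measurable_price_sub T π₀ t).aemeasurable
      (h.integrable_ξ t) (h.integrable_ζ t))
  exact this.congr (Filter.Eventually.of_forall fun ω => (loss_eq _ φ x ξ ζ t ω).symm)

lemma integral_loss_le_integral_min (h : Market μ p L B σ lam φ x ξ ζ) (T : ℕ) (π₀ : ℝ) (t : ℕ) :
    ∫ ω, loss (epochPolicy d T p B σ π₀) φ x ξ ζ t ω ∂μ
      ≤ 2 * ∫ ω, min (L * (price (epochPolicy d T p B σ π₀) φ x ξ ζ t ω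
        - marketValue φ (x t ω)) ^ 2) σ ∂μ := by
  simp_rw [loss_eq]
  rw [← integral_const_mul]
  exact integral_gain_zero_sub_gain_random_le (zero_le_one.trans h.one_le_L) h.σ_pos.le
    (h.measurable_price_sub T π₀ t) (h.measurable_ξ t) (h.measurable_ζ t) (h.integrable_ξ t)
    (h.integrable_ζ t) (h.indepFun_price_sub T π₀ t) (h.indep_noise t) (h.density_ξ t)
    (h.density_ζ t) (h.integral_abs_ξ_le t) (h.integral_abs_ζ_le t) (h.mean_ξ t) (h.mean_ζ t)

lemma integral_loss_le_two_mul (h : Market μ p L B σ lam φ x ξ ζ) (T : ℕ) (π₀ : ℝ) (t : ℕ) :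
    ∫ ω, loss (epochPolicy d T p B σ π₀) φ x ξ ζ t ω ∂μ ≤ 2 * σ := by
  refine (h.integral_loss_le_integral_min T π₀ t).trans (mul_le_mul_of_nonneg_left ?_ zero_le_two)
  refine (integral_mono_of_nonneg (g := fun _ => σ) (Filter.Eventually.of_forall fun ω =>
    le_min (mul_nonneg (zero_le_one.trans h.one_le_L) (sq_nonneg _)) h.σ_pos.le)
    (integrable_const _) (Filter.Eventually.of_forall fun ω => min_le_right _ _)).trans ?_
  simp

lemma lam_le_one (h : Market μ p L B σ lam φ x ξ ζ) : lam ≤ 1 := by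
  have j : Fin d := ⟨0, h.one_le_d⟩
  have h1 := h.posSemidef.diag_nonneg (i := j)
  simp only [Matrix.sub_apply, Matrix.smul_apply, Matrix.one_apply_eq, smul_eq_mul, mul_one,
    sub_nonneg] at h1
  rw [← h.integral_x_mul_x 1] at h1
  refine h1.trans ?_
  have hle : ∀ᵐ ω ∂μ, x 1 ω j * x 1 ω j ≤ 1 := by
    filter_upwards [h.ae_abs_x_le 1] with ω hω
    rw [← abs_mul_abs_self]
    exact mul_le_one₀ (hω j) (abs_nonneg _) (hω j)
  refine (integral_mono_ae ((h.memLp_x_mul_x 1 j j).integrable one_le_two)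
    (integrable_const _) hle).trans ?_
  simp

lemma σ_le (h : Market μ p L B σ lam φ x ξ ζ) : σ ≤ 8 * (L * d * (B + σ) ^ 2) := by
  have h1 := h.one_le_mul_σ
  have hL := h.one_le_L
  have hd : (1 : ℝ) ≤ d := by exact_mod_cast h.one_le_d
  have hσ := h.σ_pos
  have hB := h.B_pos
  calc σ ≤ σ * (8 * (L * σ)) := le_mul_of_one_le_right hσ.le h1
    _ = 8 * (L * 1 * σ ^ 2) := by ring
    _ ≤ 8 * (L * d * (B + σ) ^ 2) := by
      gcongr
      linarith

/-- The expected loss of round `t` decays like `t ^ (-(2 - 2 / p))`. -/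
lemma integral_loss_le (h : Market μ p L B σ lam φ x ξ ζ) {T : ℕ} (π₀ : ℝ) {t : ℕ}
    (ht1 : 1 ≤ t) (htT : t ≤ T) :
    ∫ ω, loss (epochPolicy d T p B σ π₀) φ x ξ ζ t ω ∂μ
      ≤ 832 * (L * d * (B + σ) ^ 2 / lam ^ 2) * (1 + Real.log (d * T))
        * (t : ℝ) ^ (-(2 - 2 / p)) := by
  have hd : (1 : ℝ) ≤ d := by exact_mod_cast h.one_le_d
  have hT : (1 : ℝ) ≤ T := by exact_mod_cast ht1.trans htT
  have hL : 0 < L := zero_lt_one.trans_le h.one_le_L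
  have hσ := h.σ_pos
  have hB := h.B_pos
  have hlam := h.lam_pos
  have hM : 0 < B + σ := by positivity
  have hσle := h.σ_le
  set K := L * d * (B + σ) ^ 2 with hK
  have hK0 : 0 < K := by positivity
  have hlog : 0 ≤ Real.log (d * T) := Real.log_nonneg (by nlinarith)
  rcases ht1.eq_or_lt with rfl | ht
  -- The price of the first round is arbitrary: bound its loss by `2 σ ≤ 16 K`.
  · refine (h.integral_loss_le_two_mul T π₀ 1).trans ?_
    rw [Nat.cast_one, Real.one_rpow, mul_one]
    have h1 : K ≤ K / lam ^ 2 :=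
      le_div_self hK0.le (by positivity) (pow_le_one₀ hlam.le h.lam_le_one)
    have h2 : 0 ≤ K / lam ^ 2 * Real.log (d * T) := by positivity
    nlinarith
  · have ht2 : 2 ≤ t := ht
    set l := Real.log (d * T)
    set n := prevLength t with hn
    have hl2 : 1 / 2 ≤ l := h.one_half_le_log (ht2.trans htT)
    have hl0 : 0 < l := by linarith
    have hn1 : (1 : ℝ) ≤ n := by exact_mod_cast prevLength_pos t
    have hn0 : (0 : ℝ) < n := by linarith
    have htn : (t : ℝ) ≤ 4 * n := by exact_mod_cast le_four_mul_prevLength ht2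
    have ha0 : 0 ≤ 2 - 2 / p := by
      rw [sub_nonneg, div_le_iff₀ (by linarith [h.one_lt_p])]
      linarith [h.one_lt_p]
    have ha1 : 2 - 2 / p ≤ 1 := by
      have : 1 ≤ 2 / p := (one_le_div (by linarith [h.one_lt_p])).2 h.p_le_two
      linarith
    obtain ⟨hτ0, hτρ, hτsq⟩ := truncation_rate (τ := truncationLevel d T p B σ n) hM h.one_lt_p
      hn0 hl0 rfl
    set τ := truncationLevel d T p B σ n
    set r := (l / n) ^ (2 - 2 / p)
    have hr0 : 0 ≤ r := by positivity
    -- Every error term is a constant times `(B + σ) ^ 2 * r`; this needs `l` bounded below.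
    have hinv : (n : ℝ)⁻¹ ≤ 2 * r := inv_le_two_mul_rpow hn1 hl2 ha0 ha1
    have hvar : (n : ℝ)⁻¹ * (τ ^ 2 * (l / n)) ≤ 2 * ((B + σ) ^ 2 * r) := by
      rw [← hτsq]
      have e1 : (n : ℝ)⁻¹ * (τ ^ 2 * (l / n)) = (τ * (l / n)) ^ 2 / l := by
        field_simp
      rw [e1, div_le_iff₀ hl0]
      nlinarith [sq_nonneg (τ * (l / n))]
    have hB2 : B ^ 2 ≤ (B + σ) ^ 2 := by gcongr; linarith
    have hmain := h.integral_min_sq_le (prevLength_pos t)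
      (a := fun s : Fin (prevLength t) => prevLength t + s)
      (fun s s' hss => Fin.ext (by simpa using hss)) hτ0 hτρ (h.ae_price_sub_sq_le T π₀ ht2)
    rw [← hn, hτsq] at hmain
    have hrt : r ≤ 4 * (1 + l) * (t : ℝ) ^ (-(2 - 2 / p)) :=
      rpow_div_le hn0 (by positivity) htn hl0.le ha0 ha1
    calc ∫ ω, loss (epochPolicy d T p B σ π₀) φ x ξ ζ t ω ∂μ
        ≤ 2 * (4 / lam ^ 2 * (L * (d * (2 * ((n : ℝ)⁻¹ * (τ ^ 2 * (l / n)) + (B + σ) ^ 2 * r)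
          + 2 * ((n : ℝ)⁻¹ * B ^ 2))) + σ * (n : ℝ)⁻¹)) :=
          (h.integral_loss_le_integral_min T π₀ t).trans
            (mul_le_mul_of_nonneg_left hmain zero_le_two)
      _ ≤ 2 * (4 / lam ^ 2 * (L * (d * (2 * (2 * ((B + σ) ^ 2 * r) + (B + σ) ^ 2 * r)
          + 2 * (2 * r * (B + σ) ^ 2))) + 8 * K * (2 * r))) := by gcongr
      _ = 208 * (K / lam ^ 2) * r := by rw [hK]; ring
      _ ≤ 208 * (K / lam ^ 2) * (4 * (1 + l) * (t : ℝ) ^ (-(2 - 2 / p))) := by gcongr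
      _ = _ := by ring

lemma regret_le (h : Market μ p L B σ lam φ x ξ ζ) {T : ℕ} (hT : 1 ≤ T) (π₀ : ℝ) :
    regret μ (epochPolicy d T p B σ π₀) φ x ξ ζ T
      ≤ 832 * ((1 + B / σ) / lam) ^ 2 * (1 + Real.log (d * T)) ^ 2
        * (L * d * σ ^ 2 * (T : ℝ) ^ ((2 - p) / p)) := by
  have hd : (1 : ℝ) ≤ d := by exact_mod_cast h.one_le_d
  have hT' : (1 : ℝ) ≤ T := by exact_mod_cast hT
  have hL : 0 < L := zero_lt_one.trans_le h.one_le_L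
  have hσ := h.σ_pos
  have hlam := h.lam_pos
  have hp : 0 < p := zero_lt_one.trans h.one_lt_p
  have ha1 : 2 - 2 / p ≤ 1 := by
    have : 1 ≤ 2 / p := (one_le_div hp).2 h.p_le_two
    linarith
  have hlog : 0 ≤ Real.log (d * T) := Real.log_nonneg (by nlinarith)
  have hlogT : Real.log T ≤ Real.log (d * T) :=
    Real.log_le_log (by linarith) (le_mul_of_one_le_left (by linarith) hd)
  have hexp : 1 - (2 - 2 / p) = (2 - p) / p := by
    field_simp
    ring
  have hsum := sum_rpow_neg_le T ha1
  rw [hexp] at hsum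
  calc regret μ (epochPolicy d T p B σ π₀) φ x ξ ζ T
      ≤ ∑ t ∈ Finset.Icc 1 T, 832 * (L * d * (B + σ) ^ 2 / lam ^ 2) * (1 + Real.log (d * T))
        * (t : ℝ) ^ (-(2 - 2 / p)) :=
        Finset.sum_le_sum fun t ht =>
          h.integral_loss_le π₀ (Finset.mem_Icc.1 ht).1 (Finset.mem_Icc.1 ht).2
    _ ≤ 832 * (L * d * (B + σ) ^ 2 / lam ^ 2) * (1 + Real.log (d * T))
        * ((1 + Real.log (d * T)) * (T : ℝ) ^ ((2 - p) / p)) := by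
        rw [← Finset.mul_sum]
        refine mul_le_mul_of_nonneg_left (hsum.trans ?_) (by positivity)
        gcongr
    _ = _ := by
        have e : B + σ = (1 + B / σ) * σ := by field_simp; ring
        rw [e]
        ring

end Market

end BilateralTrade

/-- Regret of the epoch-doubling truncated-mean algorithm for the linear market value. The constant
`C` is absolute. -/
theorem theorem1 :
    ∃ C : ℝ, 0 < C ∧
      ∀ (p : ℝ), 1 < p → p ≤ 2 →
      ∀ (d : ℕ), 1 ≤ d →
      ∀ (L B σ lam : ℝ), 1 ≤ L → 0 < B → 0 < σ → 0 < lam →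
      ∀ (φ : BilateralTrade.Context d), ‖φ‖ ≤ B →
      ∀ (Ω : Type*) [MeasurableSpace Ω] (μ : Measure Ω) [IsProbabilityMeasure μ]
        (x : ℕ → Ω → BilateralTrade.Context d) (ξ ζ : ℕ → Ω → ℝ),
        (∀ t, Measurable (x t)) → (∀ t, Measurable (ξ t)) → (∀ t, Measurable (ζ t)) →
        -- the contexts and the two noises are mutually independent, within and across rounds
        iIndepFun (fun t ω => (x t ω, ξ t ω, ζ t ω)) μ →
        (∀ t, IndepFun (x t) (fun ω => (ξ t ω, ζ t ω)) μ) →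
        (∀ t, IndepFun (ξ t) (ζ t) μ) →
        -- identically distributed contexts in the unit ball with `E[x xᵀ] ⪰ lam I`
        (∀ t, IdentDistrib (x t) (x 1) μ μ) →
        (∀ t, ∀ᵐ ω ∂μ, ‖x t ω‖ ≤ 1) →
        (BilateralTrade.secondMoment (x 1) μ
          - lam • (1 : Matrix (Fin d) (Fin d) ℝ)).PosSemidef →
        -- centred noises with densities bounded by `L` and `p`-th moments at most `σ ^ p`
        (∀ t, BilateralTrade.HasDensityBoundedBy (ξ t) μ L) →
        (∀ t, BilateralTrade.HasDensityBoundedBy (ζ t) μ L) →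
        (∀ t, ∫⁻ ω, ENNReal.ofReal (|ξ t ω| ^ p) ∂μ ≤ ENNReal.ofReal (σ ^ p)) →
        (∀ t, ∫⁻ ω, ENNReal.ofReal (|ζ t ω| ^ p) ∂μ ≤ ENNReal.ofReal (σ ^ p)) →
        (∀ t, ∫ ω, ξ t ω ∂μ = 0) →
        (∀ t, ∫ ω, ζ t ω ∂μ = 0) →
      ∀ (T : ℕ), 1 ≤ T → ∀ (π₀ : ℝ),
        (∀ t ∈ Finset.Icc 1 T, Integrable
          (BilateralTrade.loss (BilateralTrade.epochPolicy d T p B σ π₀) φ x ξ ζ t) μ) ∧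
        BilateralTrade.regret μ (BilateralTrade.epochPolicy d T p B σ π₀) φ x ξ ζ T ≤
          C * ((1 + B / σ) / lam) ^ 2 * (1 + Real.log (d * T)) ^ 2
            * (L * d * σ ^ 2 * (T : ℝ) ^ ((2 - p) / p)) := by
  refine ⟨832, by norm_num, ?_⟩
  intro p hp1 hp2 d hd L B σ lam hL hB hσ hlam φ hφ Ω _ μ _ x ξ ζ hxm hξm hζm hind hindx hindn
    hid hx hpsd hξd hζd hξp hζp hξ0 hζ0 T hT π₀
  have h : BilateralTrade.Market μ p L B σ lam φ x ξ ζ :=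
    ⟨hp1, hp2, hd, hL, hB, hσ, hlam, hφ, hxm, hξm, hζm, hind, hindx, hindn, hid, hx, hpsd, hξd,
      hζd, hξp, hζp, hξ0, hζ0⟩
  exact ⟨fun t _ => h.integrable_loss T π₀ t, h.regret_le hT π₀⟩
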